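/- Let $p\in(1,\infty)$ and $\frac1p+\frac1q=1$, and let $\varepsilon_0>0$, $\delta\in(0,\infty)$. Let $n\to\infty$, with dimensions $d=d(n)$ satisfying $n/d\to\delta$, and let $\mu=\mu_n\in\mathbb R^{d}$ be vectors such that the empirical distribution $\frac1d\sum_{i=1}^d\delta_{\sqrt d\,\mu_i}$ of the entries of $\sqrt d\,\mu$ converges weakly to a probability measure $\mathbb P_M$ on $\mathbb R$ with $\sigma_{M,2}^2=\int x^2\,d\mathbb P_M(x)\in(0,\infty)$ and $\sigma_{M,p}^p=\int|x|^p\,d\mathbb P_M(x)<\infty$, and such that the second and $p$-th absolute moments of the empirical distribution converge to those of $\mathbb P_M$, i.e. $\frac1d\sum_i|\sqrt d\,\mu_i|^2\to\sigma_{M,2}^2$ and $\frac1d\sum_i|\sqrt d\,\mu_i|^p\to\sigma_{M,p}^p$. For $\alpha\ge0$ and $\theta\in\mathbb R$ set $$\mathcal S(\alpha,\theta,\varepsilon_0,\mu)=\Big\{z\in\mathbb R^d:\ z^T\mu=0,\ \|z\|_2\le\alpha,\ \Big\|z+\theta\tfrac{\mu}{\|\mu\|_2}\Big\|_q\le\tfrac1{\varepsilon_0\|\mu\|_p}\Big\},\qquad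 \omega_s(\mathcal S)=\mathbb E\Big[\sup_{z\in\mathcal S}z^Tu\Big],$$ with $u$ uniformly distributed on the unit sphere of $\mathbb R^d$, and let $J_q(x;\lambda)=\min_{u\in\mathbb R}\frac12(x-u)^2+\lambda|u|^q$. Let $h\sim\mathcal N(0,1)$ and $M\sim\mathbb P_M$ be independent. Then, for all $\alpha\ge 0$ and $\theta\in\mathbb R$ such that $\mathcal S(\alpha,\theta,\varepsilon_0,\mu_n)$ is nonempty for all large $n$, the limit $\omega(\alpha,\theta,\varepsilon_0)=\lim_{n\to\infty}\omega_s(\mathcal S(\alpha,\theta,\varepsilon_0,\mu_n))$ exists, is finite, and equals $$\inf_{\lambda_0\ge0,\ \eta>0,\ \nu\in\mathbb R}\ \sqrt\delta\Big\{\frac{\nu^2}{2\eta}+\frac1{2\eta\delta}+\frac\eta2\alpha^2+\lambda_0(\varepsilon_0\sigma_{M,p})^{-q}\Big\}-\eta\sqrt\delta\;\mathbb E\Big[J_q\Big(\frac{h}{\eta\sqrt\delta}-\Big(\frac\nu\eta-\theta\Big)\frac{M}{\sigma_{M,2}};\frac{\lambda_0}{\eta}\Big)\Big],$$ where all these expectations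 are finite. -/

import Mathlib

open MeasureTheory ProbabilityTheory Filter Topology
open scoped NNReal

noncomputable section

namespace RobustWidth

/-- The `ℓ_r` norm `(∑ |v_i|^r)^(1/r)` of a real vector, for a finite exponent `r`. -/
def ellNorm {ι : Type*} [Fintype ι] (r : ℝ) (v : ι → ℝ) : ℝ :=
  (∑ i, |v i| ^ r) ^ (1 / r)

/-- The empirical distribution `(1/N) ∑ δ_{v_i}` of the `N` entries of a vector. -/
def empirical {ι : Type*} [Fintype ι] (v : ι → ℝ) : FiniteMeasure ℝ :=
  ((Fintype.card ι : ℝ≥0)⁻¹) • ∑ i, (diracProba (v i)).toFiniteMeasure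

/-- The set of all `z` with `⟨z, μ⟩ = 0`, `‖z‖₂ ≤ α` and
`‖z + θ μ / ‖μ‖₂‖_q ≤ 1 / (ε₀ ‖μ‖_p)`. -/
def constraintSet {d : ℕ} (p q α θ ε₀ : ℝ) (μ : EuclideanSpace ℝ (Fin d)) :
    Set (EuclideanSpace ℝ (Fin d)) :=
  {z | inner ℝ z μ = 0 ∧ ‖z‖ ≤ α ∧
    ellNorm q (fun i => z i + θ * (μ i / ‖μ‖)) ≤ 1 / (ε₀ * ellNorm p (fun i => μ i))}

/-- The spherical width `E [sup_{z ∈ S} ⟨z, u⟩]`, with `u` uniform on the unit sphere: the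
average is taken with respect to the surface measure of the sphere. -/
def sphericalWidth {d : ℕ} (S : Set (EuclideanSpace ℝ (Fin d))) : ℝ :=
  ⨍ u : Metric.sphere (0 : EuclideanSpace ℝ (Fin d)) 1,
    sSup ((fun z => inner ℝ z (u : EuclideanSpace ℝ (Fin d))) '' S)
      ∂((volume : Measure (EuclideanSpace ℝ (Fin d))).toSphere)

/-- `J_q(x; lam) = min_u (x - u)² / 2 + lam |u|^q`. -/
def J (q x lam : ℝ) : ℝ :=
  ⨅ u : ℝ, (1 / 2 * (x - u) ^ 2 + lam * |u| ^ q)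

/-- `σ_{M,r} = (∫ |x|^r dP)^(1/r)`. -/
def sigma (r : ℝ) (P : Measure ℝ) : ℝ :=
  (∫ x, |x| ^ r ∂P) ^ (1 / r)

/-- The random variable `J_q(h / (η √δ) - (ν/η - θ) M / σ_{M,2}; lam / η)` as a function of the
pair `(h, M)`. -/
def envelope (q δ θ : ℝ) (P : Measure ℝ) (lam η ν : ℝ) (hM : ℝ × ℝ) : ℝ :=
  J q (hM.1 / (η * √δ) - (ν / η - θ) * (hM.2 / sigma 2 P)) (lam / η)

/-- The objective of the scalar optimization problem in `(lam, η, ν)`; the pair `(h, M)` of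
independent variables `h ∼ N(0,1)`, `M ∼ P` is integrated out against its (product) law. -/
def objective (p q δ α θ ε₀ : ℝ) (P : Measure ℝ) (lam η ν : ℝ) : ℝ :=
  √δ * (ν ^ 2 / (2 * η) + 1 / (2 * η * δ) + η / 2 * α ^ 2 + lam * (ε₀ * sigma p P) ^ (-q))
    - η * √δ * ∫ hM, envelope q δ θ P lam η ν hM ∂((gaussianReal 0 1).prod P)

end RobustWidth

end

/-!
Write `v i = √d μ i`, `A = α² + θ²`, `B = (ε₀ σ_p)^(-q)`, and let `M ∼ P`, `h ∼ N(0,1)` be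
independent. In the coordinates `W i = √d (z i + θ μ i / ‖μ‖)` the constraint set consists of the
vectors with `avg (W v) = θ ‖μ‖`, `avg W² ≤ A` and `avg |W|^q ≤ Bₙ`, where `Bₙ → B`
(`mem_constraintSet_iff`; the powers of `d` cancel because `1/p + 1/q = 1`). A support function is
positively homogeneous, so its average over the sphere is its Gaussian mean divided by the mean
norm of a Gaussian vector (`sphere_average_eq`). Up to a factor tending to one, the width is thus
the Gaussian mean of the maximum of `avg (W g)`, and the limiting problem is to maximize `E[W h]`
over random variables `W` with `E[W M] = θ σ`, `E[W²] ≤ A`, `E|W|^q ≤ B`. The objective of the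
theorem is the Lagrangian dual function of that problem (`objective_eq_dualValue`), after a
rescaling of the multipliers by `√δ`.

*Upper bound.* Weak duality at finite dimension bounds the Gaussian mean by averages over the
entries of `v`, and these converge to the dual function, because weak convergence together with
convergence of the second moment passes to continuous functions of quadratic growth
(`tendsto_avg_of_quadratic`, `eventually_integral_supportFn_lt`).

*Lower bound.* The width is nonnegative, so only a positive infimum `ω` of the dual function needs
an argument. Separating `(θ σ, A, B, ω)` from the convex set of values attained by bounded
continuous functions `F (h, M)` shows that some `F` violate the constraints arbitrarily little and
have `E[F h]` arbitrarily close to `ω` (`mem_closure_attainable`). Such an `F` is correlated with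
`h`, whereas its average with the reflection `F (-h, M)` is not; by the strict convexity of both
inequality constraints that average satisfies them with a margin which does not depend on how
small the violation was (`exists_sub_mul_le_gap`). Moving `F` slightly towards it gives a strictly
feasible function (`exists_strictly_feasible`). No constraint qualification has to be assumed:
positivity of `ω` supplies it. Finally `W i = F (g i, v i)`, corrected by a small multiple of a
function of `v i` to restore the linear constraint, is feasible with high probability by the law
of large numbers and has `avg (W g)` close to `E[F h]` (`le_supportFn_div_add`,
`eventually_lt_integral_supportFn`).
-/


namespace RobustWidth

/-! ### Polar coordinates for the Gaussian measure -/

lemma pi_gaussian_eq_withDensity (d : ℕ) :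
    Measure.pi (fun _ : Fin d => gaussianReal 0 1) =
      (volume : Measure (Fin d → ℝ)).withDensity
        (fun x => ENNReal.ofReal (∏ i, gaussianPDFReal 0 1 (x i))) := by
  refine Measure.pi_eq ?_
  intro s hs
  rw [withDensity_apply _ (MeasurableSet.univ_pi hs)]
  have hint : ∀ i, Integrable ((s i).indicator (gaussianPDFReal 0 1)) :=
    fun i => (integrable_gaussianPDFReal 0 1).indicator (hs i)
  have hprod : Integrable (fun x : Fin d → ℝ => ∏ i, (s i).indicator (gaussianPDFReal 0 1) (x i)) :=
    Integrable.fintype_prod (ι := Fin d) hint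
  have hind : ∀ x : Fin d → ℝ, (Set.univ.pi s).indicator
      (fun x => ENNReal.ofReal (∏ i, gaussianPDFReal 0 1 (x i))) x =
      ENNReal.ofReal (∏ i, (s i).indicator (gaussianPDFReal 0 1) (x i)) := by
    intro x
    by_cases hx : x ∈ Set.univ.pi s
    · rw [Set.indicator_of_mem hx]
      congr 1
      refine Finset.prod_congr rfl fun i _ => ?_
      rw [Set.indicator_of_mem (hx i trivial)]
    · rw [Set.indicator_of_notMem hx]
      simp only [Set.mem_pi, Set.mem_univ, true_implies, not_forall] at hx
      obtain ⟨i, hi⟩ := hx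
      rw [Finset.prod_eq_zero (Finset.mem_univ i) (Set.indicator_of_notMem hi _)]
      simp
  have hnn : ∀ (i : Fin d) (x : ℝ), 0 ≤ (s i).indicator (gaussianPDFReal 0 1) x := fun i x =>
    Set.indicator_nonneg (fun y _ => gaussianPDFReal_nonneg 0 1 y) x
  rw [← lintegral_indicator (MeasurableSet.univ_pi hs)]
  simp_rw [hind]
  rw [← ofReal_integral_eq_lintegral_ofReal hprod
    (ae_of_all _ fun x => Finset.prod_nonneg fun i _ => hnn i _),
    integral_fintype_prod_volume_eq_prod, ENNReal.ofReal_prod_of_nonneg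
      (fun i _ => integral_nonneg (hnn i))]
  refine Finset.prod_congr rfl fun i _ => ?_
  rw [gaussianReal_apply_eq_integral 0 one_ne_zero, integral_indicator (hs i)]

/-- The standard Gaussian measure has a density which depends on the Euclidean norm only. -/
lemma integral_pi_gaussian_eq (d : ℕ) (f : EuclideanSpace ℝ (Fin d) → ℝ) :
    ∫ g, f (WithLp.toLp 2 g) ∂(Measure.pi (fun _ : Fin d => gaussianReal 0 1)) =
      ∫ x : EuclideanSpace ℝ (Fin d),
        ((√(2 * Real.pi))⁻¹ ^ d * Real.exp (-‖x‖ ^ 2 / 2)) * f x := by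
  have hpdf : ∀ x : Fin d → ℝ, ∏ i, gaussianPDFReal 0 1 (x i) = (√(2 * Real.pi))⁻¹ ^ d *
      Real.exp (-‖(WithLp.toLp 2 x : EuclideanSpace ℝ (Fin d))‖ ^ 2 / 2) := by
    intro x
    simp only [gaussianPDFReal, Finset.prod_mul_distrib, Finset.prod_const, ← Real.exp_sum,
      EuclideanSpace.real_norm_sq_eq]
    simp [Finset.sum_div, Finset.sum_neg_distrib, neg_div]
  rw [pi_gaussian_eq_withDensity, ← (PiLp.volume_preserving_toLp (Fin d)).integral_comp
    (MeasurableEquiv.toLp 2 _).measurableEmbedding]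
  rw [integral_withDensity_eq_integral_toReal_smul]
  · refine integral_congr_ae (ae_of_all _ fun x => ?_)
    simp only [smul_eq_mul]
    rw [ENNReal.toReal_ofReal (Finset.prod_nonneg fun i _ => gaussianPDFReal_nonneg _ _ _), hpdf]
  · fun_prop
  · exact ae_of_all _ fun x => ENNReal.ofReal_lt_top

/-- Integration in polar coordinates of a positively homogeneous function of degree one against
a radial density. -/
lemma integral_mul_homogeneous {E : Type*} [NormedAddCommGroup E] [NormedSpace ℝ E]
    [FiniteDimensional ℝ E] [MeasurableSpace E] [BorelSpace E] (m : Measure E)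
    [m.IsAddHaarMeasure] [Nontrivial E] (φ : ℝ → ℝ) (f : E → ℝ)
    (hf : ∀ (r : ℝ) (x : E), 0 < r → f (r • x) = r * f x) :
    ∫ x, φ ‖x‖ * f x ∂m = (∫ u : Metric.sphere (0 : E) 1, f u ∂m.toSphere) *
      ∫ r : Set.Ioi (0 : ℝ), φ r * r ∂(Measure.volumeIoiPow (Module.finrank ℝ E - 1)) := by
  let F : Metric.sphere (0 : E) 1 × Set.Ioi (0 : ℝ) → ℝ := fun p => f p.1 * (φ p.2 * p.2)
  have h1 : ∀ x : ({0}ᶜ : Set E), F (homeomorphUnitSphereProd E x) = φ ‖x.1‖ * f x.1 := by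
    intro x
    have hx : 0 < ‖x.1‖ := norm_pos_iff.2 x.2
    have h2 : f x.1 = ‖x.1‖ * f (‖x.1‖⁻¹ • x.1) := by
      rw [← hf _ _ hx, smul_smul, mul_inv_cancel₀ hx.ne', one_smul]
    simp only [F, homeomorphUnitSphereProd_apply_snd_coe, homeomorphUnitSphereProd_apply_fst_coe]
    rw [h2]; ring
  have hmp := m.measurePreserving_homeomorphUnitSphereProd.integral_comp
    (Homeomorph.measurableEmbedding _) F
  calc ∫ x : E, φ ‖x‖ * f x ∂m
      = ∫ x : ({(0)}ᶜ : Set E), φ ‖x.1‖ * f x.1 ∂(m.comap (↑)) := by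
        rw [integral_subtype_comap (measurableSet_singleton _).compl fun x : E => φ ‖x‖ * f x,
          restrict_compl_singleton]
    _ = ∫ p, F p ∂(m.toSphere.prod (Measure.volumeIoiPow (Module.finrank ℝ E - 1))) := by
        rw [← hmp]
        exact integral_congr_ae (ae_of_all _ fun x => (h1 x).symm)
    _ = _ := integral_prod_mul (fun u : Metric.sphere (0 : E) 1 => f u)
          (fun r : Set.Ioi (0 : ℝ) => φ r * r)

/-- For a positively homogeneous function of degree one, the average over the unit sphere is the
Gaussian mean divided by the mean of the norm of a standard Gaussian vector. -/
lemma sphere_average_eq {d : ℕ} (hd : 0 < d) (f : EuclideanSpace ℝ (Fin d) → ℝ)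
    (hf : ∀ (r : ℝ) (x : EuclideanSpace ℝ (Fin d)), 0 < r → f (r • x) = r * f x)
    (hne : ∫ g, ‖(WithLp.toLp 2 g : EuclideanSpace ℝ (Fin d))‖
        ∂(Measure.pi (fun _ : Fin d => gaussianReal 0 1)) ≠ 0) :
    (⨍ u : Metric.sphere (0 : EuclideanSpace ℝ (Fin d)) 1, f u
        ∂((volume : Measure (EuclideanSpace ℝ (Fin d))).toSphere)) =
      (∫ g, f (WithLp.toLp 2 g) ∂(Measure.pi (fun _ : Fin d => gaussianReal 0 1))) /
      ∫ g, ‖(WithLp.toLp 2 g : EuclideanSpace ℝ (Fin d))‖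
        ∂(Measure.pi (fun _ : Fin d => gaussianReal 0 1)) := by
  have : Nonempty (Fin d) := ⟨⟨0, hd⟩⟩
  set φ : ℝ → ℝ := fun r => (√(2 * Real.pi))⁻¹ ^ d * Real.exp (-r ^ 2 / 2)
  have h1 := integral_mul_homogeneous volume φ f hf
  have h2 := integral_mul_homogeneous volume φ
    (fun x : EuclideanSpace ℝ (Fin d) => ‖x‖)
    (fun r x hr => by rw [norm_smul, Real.norm_of_nonneg hr.le])
  rw [integral_pi_gaussian_eq d f]
  rw [integral_pi_gaussian_eq d (fun x => ‖x‖)] at hne ⊢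
  rw [average_eq, h1, h2]
  rw [h2] at hne
  have h3 : ∀ u : Metric.sphere (0 : EuclideanSpace ℝ (Fin d)) 1,
      ‖(u : EuclideanSpace ℝ (Fin d))‖ = 1 := fun u => by simp
  simp only [h3, integral_const, smul_eq_mul, mul_one] at hne ⊢
  rw [mul_div_mul_right _ _ (right_ne_zero_of_mul hne), inv_mul_eq_div]

/-! ### Averages and empirical distributions -/

/-- The average of the entries of a vector. -/
noncomputable def avg {d : ℕ} (x : Fin d → ℝ) : ℝ := (d : ℝ)⁻¹ * ∑ i, x i

lemma avg_add {d : ℕ} (x y : Fin d → ℝ) : avg (fun i => x i + y i) = avg x + avg y := by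
  simp [avg, Finset.sum_add_distrib, mul_add]

lemma avg_sub {d : ℕ} (x y : Fin d → ℝ) : avg (fun i => x i - y i) = avg x - avg y := by
  simp [avg, Finset.sum_sub_distrib, mul_sub]

lemma avg_const_mul {d : ℕ} (c : ℝ) (x : Fin d → ℝ) : avg (fun i => c * x i) = c * avg x := by
  simp only [avg, ← Finset.mul_sum]; ring

lemma avg_mono {d : ℕ} {x y : Fin d → ℝ} (h : ∀ i, x i ≤ y i) : avg x ≤ avg y :=
  mul_le_mul_of_nonneg_left (Finset.sum_le_sum fun i _ => h i) (by positivity)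

lemma avg_nonneg {d : ℕ} {x : Fin d → ℝ} (h : ∀ i, 0 ≤ x i) : 0 ≤ avg x :=
  mul_nonneg (by positivity) (Finset.sum_nonneg fun i _ => h i)

lemma avg_const {d : ℕ} (hd : 0 < d) (c : ℝ) : avg (fun _ : Fin d => c) = c := by
  have : (d : ℝ) ≠ 0 := by positivity
  simp [avg, this]

lemma integral_empirical {d : ℕ} (v : Fin d → ℝ) (f : ℝ → ℝ) :
    ∫ x, f x ∂(empirical v : Measure ℝ) = avg (fun i => f (v i)) := by
  have h : (empirical v : Measure ℝ) = ((d : ℝ≥0)⁻¹) • ∑ i, Measure.dirac (v i) := by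
    rw [empirical, FiniteMeasure.toMeasure_smul, FiniteMeasure.toMeasure_sum]
    simp [diracProba]
    rfl
  rw [h, integral_smul_nnreal_measure, integral_finsetSum_measure
    (fun i _ => (integrable_dirac (by simp)))]
  simp [avg, NNReal.smul_def]

/-- Fatou's lemma for averages: for weakly convergent empirical distributions, the averages of a
nonnegative continuous function are asymptotically at least the mean under the limit. -/
lemma eventually_lt_avg {d : ℕ → ℕ} {v : ∀ n, Fin (d n) → ℝ} {P : ProbabilityMeasure ℝ}
    (hweak : Tendsto (fun n => empirical (v n)) atTop (𝓝 P.toFiniteMeasure))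
    {f : ℝ → ℝ} (hf : Continuous f) (hf0 : ∀ x, 0 ≤ f x) (hfi : Integrable f (P : Measure ℝ))
    {ε : ℝ} (hε : 0 < ε) :
    ∀ᶠ n in atTop, ∫ x, f x ∂(P : Measure ℝ) - ε < avg (fun i => f (v n i)) := by
  have h1 : Tendsto (fun N : ℕ => ∫ x, min (f x) N ∂(P : Measure ℝ)) atTop
      (𝓝 (∫ x, f x ∂(P : Measure ℝ))) := by
    refine tendsto_integral_of_dominated_convergence f
      (fun N => (by fun_prop : Continuous fun x => min (f x) N).aestronglyMeasurable) hfi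
      (fun N => ae_of_all _ fun x => ?_) (ae_of_all _ fun x => ?_)
    · rw [Real.norm_of_nonneg (le_min (hf0 x) (by positivity))]
      exact min_le_left _ _
    · obtain ⟨N, hN⟩ := exists_nat_ge (f x)
      refine tendsto_const_nhds.congr' ?_
      filter_upwards [eventually_ge_atTop N] with k hk
      rw [min_eq_left]
      exact hN.trans (by exact_mod_cast hk)
  obtain ⟨N, hN⟩ := ((tendsto_order.1 h1).1 (∫ x, f x ∂(P : Measure ℝ) - ε) (by linarith)).exists
  let F : BoundedContinuousFunction ℝ ℝ := BoundedContinuousFunction.ofNormedAddCommGroup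
    (fun x => min (f x) N) (by fun_prop) N (fun x => by
      rw [Real.norm_of_nonneg (le_min (hf0 x) (by positivity))]
      exact min_le_right _ _)
  have h2 := FiniteMeasure.tendsto_iff_forall_integral_tendsto.1 hweak F
  have h3 := (tendsto_order.1 h2).1 (∫ x, f x ∂(P : Measure ℝ) - ε) hN
  filter_upwards [h3] with n hn
  refine hn.trans_le ?_
  rw [integral_empirical]
  exact avg_mono fun i => min_le_left _ _

lemma eventually_pos_dim {d : ℕ → ℕ} {v : ∀ n, Fin (d n) → ℝ} {P : ProbabilityMeasure ℝ}
    (hweak : Tendsto (fun n => empirical (v n)) atTop (𝓝 P.toFiniteMeasure)) :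
    ∀ᶠ n in atTop, 0 < d n := by
  have h := eventually_lt_avg hweak (f := fun _ => 1) continuous_const (fun _ => zero_le_one)
    (integrable_const _) (ε := 1 / 2) (by norm_num)
  filter_upwards [h] with n hn
  rcases Nat.eq_zero_or_pos (d n) with h0 | h0
  · simp [avg, h0] at hn
    norm_num at hn
  · exact h0

/-- Weak convergence of the empirical distributions together with convergence of their second
moments gives convergence of the averages of all continuous functions of quadratic growth. -/
lemma tendsto_avg_of_quadratic {d : ℕ → ℕ} {v : ∀ n, Fin (d n) → ℝ} {P : ProbabilityMeasure ℝ}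
    (hweak : Tendsto (fun n => empirical (v n)) atTop (𝓝 P.toFiniteMeasure))
    (hP2 : Integrable (fun x : ℝ => x ^ 2) (P : Measure ℝ))
    (hmom : Tendsto (fun n => avg (fun i => v n i ^ 2)) atTop (𝓝 (∫ x, x ^ 2 ∂(P : Measure ℝ))))
    {f : ℝ → ℝ} (hf : Continuous f) {C : ℝ} (hfC : ∀ x, |f x| ≤ C * (1 + x ^ 2)) :
    Tendsto (fun n => avg (fun i => f (v n i))) atTop (𝓝 (∫ x, f x ∂(P : Measure ℝ))) := by
  have hQi : Integrable (fun x : ℝ => C * (1 + x ^ 2)) (P : Measure ℝ) :=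
    ((integrable_const _).add hP2).const_mul C
  have hfi : Integrable f (P : Measure ℝ) :=
    hQi.mono' hf.aestronglyMeasurable (ae_of_all _ hfC)
  have hQ : Tendsto (fun n => avg (fun i => C * (1 + v n i ^ 2))) atTop
      (𝓝 (∫ x, C * (1 + x ^ 2) ∂(P : Measure ℝ))) := by
    have h : Tendsto (fun n => C * (1 + avg (fun i => v n i ^ 2))) atTop
        (𝓝 (C * (1 + ∫ x, x ^ 2 ∂(P : Measure ℝ)))) := (hmom.const_add 1).const_mul C
    have he : ∫ x, C * (1 + x ^ 2) ∂(P : Measure ℝ) = C * (1 + ∫ x, x ^ 2 ∂(P : Measure ℝ)) := by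
      rw [integral_const_mul, integral_add (integrable_const _) hP2]
      simp
    rw [he]
    refine h.congr' ?_
    filter_upwards [eventually_pos_dim hweak] with n hn
    rw [avg_const_mul, avg_add, avg_const hn]
  have key : ∀ ε > 0, ∀ᶠ n in atTop, |avg (fun i => f (v n i)) - ∫ x, f x ∂(P : Measure ℝ)| < ε := by
    intro ε hε
    -- the Fatou bound applies to both of the nonnegative functions `C (1 + x²) ± f x`
    have h1 := eventually_lt_avg hweak (f := fun x => C * (1 + x ^ 2) - f x) (by fun_prop)
      (fun x => by linarith [le_abs_self (f x), hfC x]) (hQi.sub hfi) (half_pos hε)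
    have h2 := eventually_lt_avg hweak (f := fun x => C * (1 + x ^ 2) + f x) (by fun_prop)
      (fun x => by linarith [neg_abs_le (f x), hfC x]) (hQi.add hfi) (half_pos hε)
    rw [integral_sub hQi hfi] at h1
    rw [integral_add hQi hfi] at h2
    have h3 := (tendsto_order.1 hQ).1 _ (sub_lt_self _ (half_pos hε))
    have h4 := (tendsto_order.1 hQ).2 _ (lt_add_of_pos_right _ (half_pos hε))
    filter_upwards [h1, h2, h3, h4] with n h1 h2 h3 h4
    rw [avg_sub] at h1
    rw [avg_add] at h2
    rw [abs_lt]
    constructor <;> linarith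
  exact Metric.tendsto_nhds.2 key

/-! ### Gaussian averages and the law of large numbers -/

lemma integrable_pow_gaussian (k : ℕ) : Integrable (fun h : ℝ => h ^ k) (gaussianReal 0 1) := by
  have h := (memLp_id_gaussianReal (μ := 0) (v := 1) (k : ℝ≥0)).integrable_norm_pow'
  refine (h.mono' (by fun_prop) (ae_of_all _ fun x => ?_))
  simp

/-- The growth condition under which functions of the pair `(h, M)` are integrated: the Gaussian
variable has all moments, but the second one only has two. -/
def HasGrowth (f : ℝ × ℝ → ℝ) : Prop := ∃ C, ∀ x, |f x| ≤ C * (1 + x.1 ^ 4 + x.2 ^ 2)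

lemma HasGrowth.integrable_left {f : ℝ × ℝ → ℝ} (hf : Continuous f) (hg : HasGrowth f) (m : ℝ) :
    Integrable (fun h => f (h, m)) (gaussianReal 0 1) := by
  obtain ⟨C, hC⟩ := hg
  refine Integrable.mono' (g := fun h => C * (1 + h ^ 4 + m ^ 2)) ?_
    (by fun_prop) (ae_of_all _ fun h => hC (h, m))
  exact (((integrable_const _).add (integrable_pow_gaussian 4)).add (integrable_const _)).const_mul C

lemma HasGrowth.integrable_prod {f : ℝ × ℝ → ℝ} (hf : Continuous f) (hg : HasGrowth f)
    {P : ProbabilityMeasure ℝ} (hP2 : Integrable (fun x : ℝ => x ^ 2) (P : Measure ℝ)) :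
    Integrable f ((gaussianReal 0 1).prod (P : Measure ℝ)) := by
  obtain ⟨C, hC⟩ := hg
  refine Integrable.mono' (g := fun x => C * (1 + x.1 ^ 4 + x.2 ^ 2)) ?_
    (by fun_prop) (ae_of_all _ hC)
  exact (((integrable_const _).add ((integrable_pow_gaussian 4).comp_fst _)).add
    (hP2.comp_snd _)).const_mul C

lemma HasGrowth.mean_le {f : ℝ × ℝ → ℝ} (hg : HasGrowth f) :
    ∃ C, ∀ m, |∫ h, f (h, m) ∂(gaussianReal 0 1)| ≤ C * (1 + m ^ 2) := by
  obtain ⟨C, hC⟩ := hg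
  have hC0 : 0 ≤ C := by simpa using (abs_nonneg _).trans (hC (0, 0))
  set κ := ∫ h : ℝ, h ^ 4 ∂(gaussianReal 0 1) with hκ
  have hκ0 : 0 ≤ κ := integral_nonneg fun h => by positivity
  refine ⟨C * (1 + κ), fun m => ?_⟩
  have hi : Integrable (fun h : ℝ => 1 + h ^ 4) (gaussianReal 0 1) :=
    (integrable_const _).add (integrable_pow_gaussian 4)
  have hi' : Integrable (fun h : ℝ => 1 + h ^ 4 + m ^ 2) (gaussianReal 0 1) :=
    hi.add (integrable_const _)
  have h1 : |∫ h, f (h, m) ∂(gaussianReal 0 1)| ≤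
      ∫ h : ℝ, C * (1 + h ^ 4 + m ^ 2) ∂(gaussianReal 0 1) :=
    norm_integral_le_of_norm_le (f := fun h => f (h, m)) (hi'.const_mul C)
      (ae_of_all _ fun h => hC (h, m))
  refine h1.trans ?_
  rw [integral_const_mul, integral_add hi (integrable_const _),
    integral_add (integrable_const _) (integrable_pow_gaussian 4)]
  simp only [integral_const, probReal_univ, smul_eq_mul, one_mul, ← hκ]
  rw [mul_assoc]
  refine mul_le_mul_of_nonneg_left ?_ hC0
  nlinarith [mul_nonneg hκ0 (sq_nonneg m)]

lemma HasGrowth.continuous_mean {f : ℝ × ℝ → ℝ} (hf : Continuous f) (hg : HasGrowth f) :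
    Continuous (fun m => ∫ h, f (h, m) ∂(gaussianReal 0 1)) := by
  obtain ⟨C, hC⟩ := hg
  have hC0 : 0 ≤ C := by simpa using (abs_nonneg _).trans (hC (0, 0))
  rw [continuous_iff_continuousAt]
  intro m₀
  refine continuousAt_of_dominated (bound := fun h => C * (1 + h ^ 4 + (|m₀| + 1) ^ 2))
    (Eventually.of_forall fun m => by fun_prop) ?_ ?_ (ae_of_all _ fun h => by fun_prop)
  · filter_upwards [Metric.ball_mem_nhds m₀ one_pos] with m hm
    refine ae_of_all _ fun h => (hC (h, m)).trans ?_
    have h1 : |m| ≤ |m₀| + 1 := by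
      rw [Metric.mem_ball, Real.dist_eq] at hm
      linarith [abs_sub_abs_le_abs_sub m m₀]
    have h2 : m ^ 2 ≤ (|m₀| + 1) ^ 2 := by
      rw [← sq_abs]; gcongr
    gcongr
  · exact (((integrable_const _).add (integrable_pow_gaussian 4)).add
      (integrable_const _)).const_mul C

/-- The averages of the conditional means of `f (h, M)` given `M` converge to the mean. -/
lemma tendsto_avg_mean {d : ℕ → ℕ} {v : ∀ n, Fin (d n) → ℝ} {P : ProbabilityMeasure ℝ}
    (hweak : Tendsto (fun n => empirical (v n)) atTop (𝓝 P.toFiniteMeasure))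
    (hP2 : Integrable (fun x : ℝ => x ^ 2) (P : Measure ℝ))
    (hmom : Tendsto (fun n => avg (fun i => v n i ^ 2)) atTop (𝓝 (∫ x, x ^ 2 ∂(P : Measure ℝ))))
    {f : ℝ × ℝ → ℝ} (hf : Continuous f) (hg : HasGrowth f) :
    Tendsto (fun n => avg (fun i => ∫ h, f (h, v n i) ∂(gaussianReal 0 1))) atTop
      (𝓝 (∫ x, f x ∂((gaussianReal 0 1).prod (P : Measure ℝ)))) := by
  obtain ⟨C, hC⟩ := hg.mean_le
  rw [integral_prod_symm _ (hg.integrable_prod hf hP2)]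
  exact tendsto_avg_of_quadratic hweak hP2 hmom (hg.continuous_mean hf) hC

/-- The law of a vector with `d` independent standard normal entries. -/
noncomputable abbrev gaussianVec (d : ℕ) : Measure (Fin d → ℝ) :=
  Measure.pi (fun _ : Fin d => gaussianReal 0 1)

lemma integrable_comp_apply_gaussianVec {d : ℕ} (i : Fin d) {f : ℝ → ℝ}
    (hf : Integrable f (gaussianReal 0 1)) : Integrable (fun g => f (g i)) (gaussianVec d) :=
  (measurePreserving_eval (fun _ : Fin d => gaussianReal 0 1) i).integrable_comp_of_integrable hf

lemma integral_comp_apply_gaussianVec {d : ℕ} (i : Fin d) {f : ℝ → ℝ} (hf : Continuous f) :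
    ∫ g, f (g i) ∂(gaussianVec d) = ∫ h, f h ∂(gaussianReal 0 1) := by
  have h := measurePreserving_eval (fun _ : Fin d => gaussianReal 0 1) i
  rw [← h.map_eq, integral_map h.measurable.aemeasurable hf.aestronglyMeasurable]

lemma integrable_avg {d : ℕ} {α : Type*} [MeasurableSpace α] {m : Measure α}
    {f : Fin d → α → ℝ} (hf : ∀ i, Integrable (f i) m) :
    Integrable (fun g => avg (fun i => f i g)) m := by
  unfold avg
  exact (integrable_finsetSum _ fun i _ => hf i).const_mul _

lemma integral_avg {d : ℕ} {α : Type*} [MeasurableSpace α] {m : Measure α}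
    {f : Fin d → α → ℝ} (hf : ∀ i, Integrable (f i) m) :
    ∫ g, avg (fun i => f i g) ∂m = avg (fun i => ∫ g, f i g ∂m) := by
  unfold avg
  rw [integral_const_mul, integral_finsetSum _ fun i _ => hf i]

/-- Chebyshev bound in `L¹` for an average of independent functions of standard normal
variables. -/
lemma sq_integral_abs_avg_sub_le {d : ℕ} {f : Fin d → ℝ → ℝ} (hf : ∀ i, Continuous (f i))
    (hf2 : ∀ i, MemLp (f i) 2 (gaussianReal 0 1)) :
    (∫ g, |avg (fun i => f i (g i)) - avg (fun i => ∫ h, f i h ∂(gaussianReal 0 1))|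
      ∂(gaussianVec d)) ^ 2 ≤
      (d : ℝ)⁻¹ * avg (fun i => ∫ h, f i h ^ 2 ∂(gaussianReal 0 1)) := by
  have hint : ∀ i, Integrable (fun g => f i (g i)) (gaussianVec d) := fun i =>
    integrable_comp_apply_gaussianVec i ((hf2 i).integrable (by norm_num))
  set X : (Fin d → ℝ) → ℝ := fun g => avg (fun i => f i (g i)) with hX
  have hm : ∫ g, X g ∂(gaussianVec d) = avg (fun i => ∫ h, f i h ∂(gaussianReal 0 1)) := by
    rw [hX, integral_avg hint]
    simp_rw [integral_comp_apply_gaussianVec _ (hf _)]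
  have hsum2 : MemLp (fun g : Fin d → ℝ => ∑ i, f i (g i)) 2 (gaussianVec d) :=
    memLp_finsetSum _ fun i _ => (hf2 i).comp_measurePreserving
      (measurePreserving_eval (fun _ : Fin d => gaussianReal 0 1) i)
  have hX2 : MemLp X 2 (gaussianVec d) := hsum2.const_mul _
  have hvar : Var[X; gaussianVec d] ≤
      (d : ℝ)⁻¹ * avg (fun i => ∫ h, f i h ^ 2 ∂(gaussianReal 0 1)) := by
    have h1 : Var[X; gaussianVec d] = (d : ℝ)⁻¹ ^ 2 * ∑ i, Var[f i; gaussianReal 0 1] := by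
      have := variance_sum_pi (μ := fun _ : Fin d => gaussianReal 0 1) (X := f) hf2
      rw [← this, ← variance_const_mul]
      congr 1
      ext g
      simp [hX, avg]
    rw [h1, avg, ← mul_assoc, ← sq]
    refine mul_le_mul_of_nonneg_left (Finset.sum_le_sum fun i _ => ?_) (by positivity)
    exact variance_le_expectation_sq (hf i).aestronglyMeasurable
  rw [← hm]
  refine le_trans ?_ hvar
  set Y : (Fin d → ℝ) → ℝ := fun g => |X g - ∫ g, X g ∂(gaussianVec d)| with hY
  have hY2 : MemLp Y 2 (gaussianVec d) := (hX2.sub (memLp_const _)).abs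
  -- `(E Y)² ≤ E Y²`, and the right-hand side is the variance of `X`
  have h2 := variance_nonneg Y (gaussianVec d)
  rw [variance_eq_sub hY2] at h2
  rw [variance_eq_integral hX2.aestronglyMeasurable.aemeasurable]
  have h3 : ∀ g, (Y ^ 2) g = (X g - ∫ g, X g ∂(gaussianVec d)) ^ 2 := fun g => by
    simp [hY]
  simp_rw [h3] at h2
  linarith

/-- Law of large numbers in `L¹` for the averages of `f (g i, v i)` with independent standard
normal `g i`. -/
lemma tendsto_integral_abs_avg_sub {d : ℕ → ℕ} (hd : Tendsto (fun n => (d n : ℝ)) atTop atTop)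
    {v : ∀ n, Fin (d n) → ℝ} {P : ProbabilityMeasure ℝ}
    (hweak : Tendsto (fun n => empirical (v n)) atTop (𝓝 P.toFiniteMeasure))
    (hP2 : Integrable (fun x : ℝ => x ^ 2) (P : Measure ℝ))
    (hmom : Tendsto (fun n => avg (fun i => v n i ^ 2)) atTop (𝓝 (∫ x, x ^ 2 ∂(P : Measure ℝ))))
    {f : ℝ × ℝ → ℝ} (hf : Continuous f) (hg : HasGrowth f) (hg2 : HasGrowth (fun x => f x ^ 2)) :
    Tendsto (fun n => ∫ g, |avg (fun i => f (g i, v n i)) -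
        ∫ x, f x ∂((gaussianReal 0 1).prod (P : Measure ℝ))| ∂(gaussianVec (d n)))
      atTop (𝓝 0) := by
  set e := ∫ x, f x ∂((gaussianReal 0 1).prod (P : Measure ℝ))
  have h1 := tendsto_avg_mean hweak hP2 hmom hf hg
  have h2 := tendsto_avg_mean hweak hP2 hmom (by fun_prop) hg2
  have h3 : Tendsto (fun n => √((d n : ℝ)⁻¹ *
      avg (fun i => ∫ h, f (h, v n i) ^ 2 ∂(gaussianReal 0 1)))) atTop (𝓝 0) := by
    have := ((tendsto_inv_atTop_zero.comp hd).mul h2).sqrt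
    simpa using this
  have h4 : Tendsto (fun n => √((d n : ℝ)⁻¹ *
      avg (fun i => ∫ h, f (h, v n i) ^ 2 ∂(gaussianReal 0 1))) +
      |avg (fun i => ∫ h, f (h, v n i) ∂(gaussianReal 0 1)) - e|) atTop (𝓝 0) := by
    have := h3.add ((h1.sub_const e).abs)
    simpa [e] using this
  refine squeeze_zero (fun n => integral_nonneg fun g => abs_nonneg _) (fun n => ?_) h4
  have hm2 : ∀ m, MemLp (fun h => f (h, m)) 2 (gaussianReal 0 1) := fun m => by
    rw [memLp_two_iff_integrable_sq (by fun_prop)]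
    exact hg2.integrable_left (by fun_prop) m
  have h5 := Real.le_sqrt_of_sq_le (sq_integral_abs_avg_sub_le (f := fun i h => f (h, v n i))
    (fun i => by fun_prop) (fun i => hm2 _))
  set a := avg (fun i => ∫ h, f (h, v n i) ∂(gaussianReal 0 1))
  have hi : Integrable (fun g => avg (fun i => f (g i, v n i))) (gaussianVec (d n)) :=
    integrable_avg fun i => integrable_comp_apply_gaussianVec i (f := fun h => f (h, v n i))
      (hg.integrable_left hf _)
  have hi1 : Integrable (fun g => |avg (fun i => f (g i, v n i)) - a|) (gaussianVec (d n)) :=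
    (hi.sub (integrable_const _)).abs
  have hi2 : Integrable (fun g => |avg (fun i => f (g i, v n i)) - e|) (gaussianVec (d n)) :=
    (hi.sub (integrable_const _)).abs
  calc ∫ g, |avg (fun i => f (g i, v n i)) - e| ∂(gaussianVec (d n))
      ≤ ∫ g, (|avg (fun i => f (g i, v n i)) - a| + |a - e|) ∂(gaussianVec (d n)) := by
        refine integral_mono hi2 (hi1.add (integrable_const _)) fun g => ?_
        exact abs_sub_le _ _ _
    _ = ∫ g, |avg (fun i => f (g i, v n i)) - a| ∂(gaussianVec (d n)) + |a - e| := by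
        rw [integral_add hi1 (integrable_const _)]
        simp
    _ ≤ _ := by gcongr

/-! ### The conjugate of the penalty -/

lemma abs_rpow_convexOn {q : ℝ} (hq : 1 ≤ q) : ConvexOn ℝ Set.univ (fun u : ℝ => |u| ^ q) := by
  refine ⟨convex_univ, fun x _ y _ a b ha hb hab => ?_⟩
  have h := (convexOn_rpow hq).2 (Set.mem_Ici.2 (abs_nonneg x)) (Set.mem_Ici.2 (abs_nonneg y))
    ha hb hab
  refine le_trans ?_ h
  refine Real.rpow_le_rpow (abs_nonneg _) ?_ (by linarith)
  simp only [smul_eq_mul]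
  refine (abs_add_le _ _).trans ?_
  rw [abs_mul, abs_mul, abs_of_nonneg ha, abs_of_nonneg hb]

lemma continuous_abs_rpow {q : ℝ} (hq : 0 ≤ q) : Continuous (fun u : ℝ => |u| ^ q) :=
  continuous_abs.rpow_const fun _ => Or.inr hq

/-- The function `u ↦ y u - η u² / 2 - lam |u|^q`, whose supremum over `u` is `conj q η lam y`. -/
noncomputable def gain (q η lam y u : ℝ) : ℝ := y * u - η / 2 * u ^ 2 - lam * |u| ^ q

/-- The convex conjugate of `u ↦ η u² / 2 + lam |u|^q`. -/
noncomputable def conj (q η lam y : ℝ) : ℝ := ⨆ u, gain q η lam y u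

section Conj

variable {q η lam : ℝ}

lemma gain_le_sq (hη : 0 < η) (hl : 0 ≤ lam) (y u : ℝ) : gain q η lam y u ≤ y ^ 2 / (2 * η) := by
  have h1 : 0 ≤ lam * |u| ^ q := mul_nonneg hl (Real.rpow_nonneg (abs_nonneg _) _)
  have h2 : y ^ 2 / (2 * η) - (y * u - η / 2 * u ^ 2) = (y - η * u) ^ 2 / (2 * η) := by
    field_simp; ring
  have h3 : 0 ≤ (y - η * u) ^ 2 / (2 * η) := by positivity
  unfold gain
  linarith

lemma bddAbove_gain (hη : 0 < η) (hl : 0 ≤ lam) (y : ℝ) :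
    BddAbove (Set.range (gain q η lam y)) :=
  ⟨y ^ 2 / (2 * η), by rintro _ ⟨u, rfl⟩; exact gain_le_sq hη hl y u⟩

lemma gain_le_conj (hη : 0 < η) (hl : 0 ≤ lam) (y u : ℝ) : gain q η lam y u ≤ conj q η lam y :=
  le_ciSup (bddAbove_gain hη hl y) u

lemma conj_le_sq (hη : 0 < η) (hl : 0 ≤ lam) (y : ℝ) : conj q η lam y ≤ y ^ 2 / (2 * η) :=
  ciSup_le fun u => gain_le_sq hη hl y u

lemma gain_zero (hq : 0 < q) (y : ℝ) : gain q η lam y 0 = 0 := by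
  simp [gain, Real.zero_rpow hq.ne']

lemma conj_nonneg (hq : 0 < q) (hη : 0 < η) (hl : 0 ≤ lam) (y : ℝ) : 0 ≤ conj q η lam y := by
  rw [← gain_zero (q := q) (η := η) (lam := lam) hq y]
  exact gain_le_conj hη hl y 0

lemma abs_conj_le (hq : 0 < q) (hη : 0 < η) (hl : 0 ≤ lam) (y : ℝ) :
    |conj q η lam y| ≤ y ^ 2 / (2 * η) := by
  rw [abs_of_nonneg (conj_nonneg hq hη hl y)]
  exact conj_le_sq hη hl y

/-- The conjugate is finite and convex on the line, hence continuous. -/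
lemma continuous_conj (hη : 0 < η) (hl : 0 ≤ lam) : Continuous (conj q η lam) := by
  have h : ConvexOn ℝ Set.univ (conj q η lam) := by
    refine ⟨convex_univ, fun x _ y _ a b ha hb hab => ciSup_le fun u => ?_⟩
    have h1 := mul_le_mul_of_nonneg_left (gain_le_conj (q := q) hη hl x u) ha
    have h2 := mul_le_mul_of_nonneg_left (gain_le_conj (q := q) hη hl y u) hb
    simp only [smul_eq_mul]
    refine le_trans (le_of_eq ?_) (add_le_add h1 h2)
    unfold gain
    linear_combination (η / 2 * u ^ 2 + lam * |u| ^ q) * hab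
  rw [← continuousOn_univ]
  exact h.continuousOn isOpen_univ

lemma continuous_gain (hq : 0 < q) (y : ℝ) : Continuous (gain q η lam y) := by
  unfold gain
  have := continuous_abs_rpow hq.le
  fun_prop

lemma concaveOn_gain (hq : 1 ≤ q) (hη : 0 < η) (hl : 0 ≤ lam) (y : ℝ) :
    ConcaveOn ℝ Set.univ (gain q η lam y) := by
  have h1 : ConvexOn ℝ Set.univ (fun u : ℝ => lam * |u| ^ q) := (abs_rpow_convexOn hq).smul hl
  have h2 : ConvexOn ℝ Set.univ (fun u : ℝ => η / 2 * u ^ 2) :=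
    (even_two.convexOn_pow).smul (by positivity)
  have h3 : ConcaveOn ℝ Set.univ (fun u : ℝ => y * u) :=
    (LinearMap.mulLeft ℝ y).concaveOn convex_univ
  exact (h3.sub h2).sub h1

/-- The Moreau envelope in terms of the conjugate. -/
lemma J_eq_conj (hη : 0 < η) (hl : 0 ≤ lam) (y : ℝ) :
    η * J q (y / η) (lam / η) = y ^ 2 / (2 * η) - conj q η lam y := by
  have hterm : ∀ u, η * (1 / 2 * (y / η - u) ^ 2 + lam / η * |u| ^ q) =
      y ^ 2 / (2 * η) - gain q η lam y u := fun u => by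
    unfold gain; field_simp; ring
  have hbdd : BddBelow (Set.range fun u : ℝ => 1 / 2 * (y / η - u) ^ 2 + lam / η * |u| ^ q) :=
    ⟨0, by
      rintro _ ⟨u, rfl⟩
      have : 0 ≤ lam / η * |u| ^ q :=
        mul_nonneg (div_nonneg hl hη.le) (Real.rpow_nonneg (abs_nonneg _) _)
      positivity⟩
  refine le_antisymm ?_ ?_
  · have h : conj q η lam y ≤ y ^ 2 / (2 * η) - η * J q (y / η) (lam / η) := by
      refine ciSup_le fun u => ?_
      have := mul_le_mul_of_nonneg_left (ciInf_le hbdd u) hη.le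
      rw [hterm] at this
      unfold J
      linarith
    linarith
  · rw [J, Real.mul_iInf_of_nonneg hη.le]
    refine le_ciInf fun u => ?_
    rw [hterm]
    linarith [gain_le_conj (q := q) hη hl y u]

/-- For a finite set `s` of competitors there is a bounded continuous function of `y` whose gain is
at least the maximal gain over `s`, up to `τ`. Its value is an average of the competitors, with
weights supported on those that are within `τ` of the maximum. -/
lemma exists_continuous_near_max (hq : 1 ≤ q) (hη : 0 < η) (hl : 0 ≤ lam) {s : Finset ℝ}
    (hs : s.Nonempty) {τ : ℝ} (hτ : 0 < τ) :
    ∃ φ : BoundedContinuousFunction ℝ ℝ,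
      ∀ y, s.sup' hs (gain q η lam y) - τ ≤ gain q η lam y (φ y) := by
  set mx : ℝ → ℝ := fun y => s.sup' hs (gain q η lam y) with hmx
  have hcy : ∀ u, Continuous fun y => gain q η lam y u := fun u => by unfold gain; fun_prop
  have hmxc : Continuous mx := Continuous.finset_sup'_apply hs fun u _ => hcy u
  set w : ℝ → ℝ → ℝ := fun u y => max 0 (gain q η lam y u - mx y + τ) with hw
  have hw0 : ∀ u y, 0 ≤ w u y := fun u y => le_max_left _ _
  have hwc : ∀ u, Continuous (w u) := fun u => by
    have := hcy u
    fun_prop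
  set W : ℝ → ℝ := fun y => ∑ u ∈ s, w u y with hW
  have hWpos : ∀ y, 0 < W y := by
    intro y
    obtain ⟨u, hu, hmax⟩ := Finset.exists_mem_eq_sup' hs (gain q η lam y)
    refine Finset.sum_pos' (fun u _ => hw0 u y) ⟨u, hu, ?_⟩
    refine lt_max_of_lt_right ?_
    rw [← hmax]
    simp only [hmx]
    linarith
  have hsum1 : ∀ y, ∑ u ∈ s, w u y / W y = 1 := fun y => by
    rw [← Finset.sum_div, div_self (hWpos y).ne']
  have hp0 : ∀ u y, 0 ≤ w u y / W y := fun u y => div_nonneg (hw0 u y) (hWpos y).le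
  set φ : ℝ → ℝ := fun y => ∑ u ∈ s, (w u y / W y) * u with hφ
  have hφc : Continuous φ := by
    refine continuous_finsetSum _ fun u _ => ?_
    exact ((hwc u).div (continuous_finsetSum _ fun u _ => hwc u) fun y => (hWpos y).ne').mul
      continuous_const
  have hφb : ∀ y, ‖φ y‖ ≤ ∑ u ∈ s, |u| := by
    intro y
    refine (Finset.abs_sum_le_sum_abs _ _).trans (Finset.sum_le_sum fun u hu => ?_)
    rw [abs_mul, abs_of_nonneg (hp0 u y)]
    refine mul_le_of_le_one_left (abs_nonneg _) ?_
    rw [← hsum1 y]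
    exact Finset.single_le_sum (fun v _ => hp0 v y) hu
  refine ⟨BoundedContinuousFunction.ofNormedAddCommGroup φ hφc _ hφb, fun y => ?_⟩
  have hJ := (concaveOn_gain hq hη hl y).le_map_sum (t := s) (w := fun u => w u y / W y)
    (p := id) (fun u _ => hp0 u y) (hsum1 y) (fun _ _ => trivial)
  simp only [smul_eq_mul, id] at hJ
  refine le_trans ?_ hJ
  calc mx y - τ = ∑ u ∈ s, (w u y / W y) * (mx y - τ) := by
        rw [← Finset.sum_mul, hsum1, one_mul]
    _ ≤ ∑ u ∈ s, (w u y / W y) * gain q η lam y u := by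
        refine Finset.sum_le_sum fun u _ => ?_
        rcases le_or_gt (mx y - τ) (gain q η lam y u) with h | h
        · exact mul_le_mul_of_nonneg_left h (hp0 u y)
        · have : w u y = 0 := max_eq_left (by linarith)
          simp [this]

end Conj

/-! ### Integrals against the law of `(h, M)` -/

lemma HasGrowth.add {f g : ℝ × ℝ → ℝ} (hf : HasGrowth f) (hg : HasGrowth g) :
    HasGrowth (fun x => f x + g x) := by
  obtain ⟨C, hC⟩ := hf
  obtain ⟨D, hD⟩ := hg
  exact ⟨C + D, fun x => (abs_add_le _ _).trans (by linarith [hC x, hD x])⟩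

lemma HasGrowth.const_mul {f : ℝ × ℝ → ℝ} (c : ℝ) (hf : HasGrowth f) :
    HasGrowth (fun x => c * f x) := by
  obtain ⟨C, hC⟩ := hf
  refine ⟨|c| * C, fun x => ?_⟩
  rw [abs_mul, mul_assoc]
  exact mul_le_mul_of_nonneg_left (hC x) (abs_nonneg _)

lemma HasGrowth.mono {f g : ℝ × ℝ → ℝ} (hg : HasGrowth g) (h : ∀ x, |f x| ≤ |g x|) :
    HasGrowth f := by
  obtain ⟨C, hC⟩ := hg
  exact ⟨C, fun x => (h x).trans (hC x)⟩

lemma hasGrowth_const (c : ℝ) : HasGrowth (fun _ => c) := by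
  refine ⟨|c|, fun x => le_mul_of_one_le_right (abs_nonneg _) ?_⟩
  have : 0 ≤ x.1 ^ 4 := by positivity
  nlinarith [sq_nonneg x.2]

lemma hasGrowth_fst_pow_four : HasGrowth (fun x => x.1 ^ 4) := by
  refine ⟨1, fun x => ?_⟩
  have : 0 ≤ x.1 ^ 4 := by positivity
  rw [abs_of_nonneg this]
  nlinarith [sq_nonneg x.2]

lemma hasGrowth_fst_sq : HasGrowth (fun x => x.1 ^ 2) := by
  refine ⟨1, fun x => ?_⟩
  rw [abs_of_nonneg (by positivity)]
  nlinarith [sq_nonneg x.2, sq_nonneg (x.1 ^ 2 - 1)]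

lemma hasGrowth_snd_sq : HasGrowth (fun x => x.2 ^ 2) := by
  refine ⟨1, fun x => ?_⟩
  rw [abs_of_nonneg (by positivity)]
  have : 0 ≤ x.1 ^ 4 := by positivity
  nlinarith

lemma HasGrowth.of_sq {f : ℝ × ℝ → ℝ} (h : HasGrowth (fun x => f x ^ 2)) : HasGrowth f := by
  refine ((hasGrowth_const 1).add h).mono fun x => ?_
  rw [abs_of_nonneg (by positivity : 0 ≤ 1 + f x ^ 2)]
  nlinarith [sq_nonneg (|f x| - 1), sq_abs (f x)]

lemma HasGrowth.mul_of_sq {f g : ℝ × ℝ → ℝ} (hf : HasGrowth (fun x => f x ^ 2))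
    (hg : HasGrowth (fun x => g x ^ 2)) : HasGrowth (fun x => f x * g x) := by
  refine (hf.add hg).mono fun x => ?_
  rw [abs_of_nonneg (by positivity : 0 ≤ f x ^ 2 + g x ^ 2), abs_mul]
  nlinarith [sq_nonneg (|f x| - |g x|), sq_abs (f x), sq_abs (g x), abs_nonneg (f x),
    abs_nonneg (g x)]

lemma hasGrowth_fst : HasGrowth (fun x => x.1) := hasGrowth_fst_sq.of_sq

lemma hasGrowth_snd : HasGrowth (fun x => x.2) := hasGrowth_snd_sq.of_sq

lemma HasGrowth.bounded_mul {f g : ℝ × ℝ → ℝ} (C : ℝ) (hf : ∀ x, |f x| ≤ C) (hg : HasGrowth g) :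
    HasGrowth (fun x => f x * g x) := by
  refine (hg.const_mul C).mono fun x => ?_
  rw [abs_mul, abs_mul]
  exact mul_le_mul_of_nonneg_right ((hf x).trans (le_abs_self _)) (abs_nonneg _)

lemma hasGrowth_of_bounded {f : ℝ × ℝ → ℝ} (C : ℝ) (hf : ∀ x, |f x| ≤ C) : HasGrowth f := by
  simpa using (hasGrowth_const 1).bounded_mul C hf

/-- A square of an affine function of `(h, M)`. -/
lemma hasGrowth_sub_mul_sq (c : ℝ) : HasGrowth (fun x => (x.1 - c * x.2) ^ 2) := by
  refine ((hasGrowth_fst_sq.const_mul 2).add (hasGrowth_snd_sq.const_mul (2 * c ^ 2))).mono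
    fun x => ?_
  rw [abs_of_nonneg (by positivity), abs_of_nonneg (by positivity)]
  nlinarith [sq_nonneg (x.1 + c * x.2)]

lemma hasGrowth_conj {q η lam : ℝ} (hq : 0 < q) (hη : 0 < η) (hl : 0 ≤ lam) (c : ℝ) :
    HasGrowth (fun x => conj q η lam (x.1 - c * x.2)) := by
  refine ((hasGrowth_sub_mul_sq c).const_mul (2 * η)⁻¹).mono fun x => ?_
  rw [abs_of_nonneg (a := (2 * η)⁻¹ * _) (by positivity)]
  refine (abs_conj_le hq hη hl _).trans (le_of_eq ?_)
  rw [div_eq_inv_mul]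

lemma integral_fst_sq_gaussian : ∫ h : ℝ, h ^ 2 ∂(gaussianReal 0 1) = 1 := by
  have h := variance_fun_id_gaussianReal (μ := 0) (v := 1)
  rw [variance_eq_integral (by fun_prop)] at h
  simpa using h

lemma integral_fst_mul_comp_snd {P : ProbabilityMeasure ℝ} (f : ℝ → ℝ) :
    ∫ x : ℝ × ℝ, x.1 * f x.2 ∂((gaussianReal 0 1).prod (P : Measure ℝ)) = 0 := by
  rw [integral_prod_mul (fun h : ℝ => h) f, integral_id_gaussianReal, zero_mul]

lemma integral_sub_mul_sq {P : ProbabilityMeasure ℝ}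
    (hP2 : Integrable (fun x : ℝ => x ^ 2) (P : Measure ℝ)) (c : ℝ) :
    ∫ x : ℝ × ℝ, (x.1 - c * x.2) ^ 2 ∂((gaussianReal 0 1).prod (P : Measure ℝ)) =
      1 + c ^ 2 * ∫ x, x ^ 2 ∂(P : Measure ℝ) := by
  have h1 : Integrable (fun x : ℝ × ℝ => x.1 ^ 2) ((gaussianReal 0 1).prod (P : Measure ℝ)) :=
    hasGrowth_fst_sq.integrable_prod (by fun_prop) hP2
  have h2 : Integrable (fun x : ℝ × ℝ => x.2 ^ 2) ((gaussianReal 0 1).prod (P : Measure ℝ)) :=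
    hasGrowth_snd_sq.integrable_prod (by fun_prop) hP2
  have h3 : Integrable (fun x : ℝ × ℝ => x.1 * x.2) ((gaussianReal 0 1).prod (P : Measure ℝ)) :=
    (hasGrowth_fst_sq.mul_of_sq hasGrowth_snd_sq).integrable_prod (by fun_prop) hP2
  have h4 : ∀ x : ℝ × ℝ, (x.1 - c * x.2) ^ 2 =
      x.1 ^ 2 + c ^ 2 * x.2 ^ 2 - 2 * c * (x.1 * x.2) := fun x => by ring
  have h12 : Integrable (fun x : ℝ × ℝ => x.1 ^ 2 + c ^ 2 * x.2 ^ 2)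
      ((gaussianReal 0 1).prod (P : Measure ℝ)) := h1.add (h2.const_mul _)
  simp_rw [h4]
  rw [integral_sub h12 (h3.const_mul _), integral_add h1 (h2.const_mul _),
    integral_const_mul, integral_const_mul, integral_fst_mul_comp_snd (fun m => m),
    integral_fun_fst (fun h : ℝ => h ^ 2), integral_fun_snd (fun h : ℝ => h ^ 2),
    integral_fst_sq_gaussian]
  simp

/-! ### The dual objective -/

/-- The Lagrangian dual function of the problem of maximizing `E[W h]` over all random variables
`W` with `E[W M] = θ σ`, `E[W²] ≤ A` and `E|W|^q ≤ B`. -/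
noncomputable def dualValue (q A B θ σ : ℝ) (P : Measure ℝ) (lam η ν : ℝ) : ℝ :=
  ν * θ + η / 2 * A + lam * B +
    ∫ x, conj q η lam (x.1 - ν / σ * x.2) ∂((gaussianReal 0 1).prod P)

lemma sigma_two_sq {P : Measure ℝ} : sigma 2 P ^ 2 = ∫ x, x ^ 2 ∂P := by
  have h : ∀ x : ℝ, |x| ^ (2 : ℝ) = x ^ 2 := fun x => by
    rw [Real.rpow_two, sq_abs]
  rw [sigma]
  simp_rw [h]
  rw [← Real.sqrt_eq_rpow, Real.sq_sqrt (integral_nonneg fun x => sq_nonneg x)]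

/-- The envelope in terms of the conjugate at the multipliers `√δ lam`, `√δ η` and
`√δ (ν - η θ)`. -/
lemma envelope_eq {q δ θ lam η ν : ℝ} {P : Measure ℝ} (hδ : 0 < δ) (hη : 0 < η) (hl : 0 ≤ lam)
    (x : ℝ × ℝ) :
    η * √δ * envelope q δ θ P lam η ν x =
      (x.1 - √δ * (ν - η * θ) / sigma 2 P * x.2) ^ 2 / (2 * (√δ * η)) -
        conj q (√δ * η) (√δ * lam) (x.1 - √δ * (ν - η * θ) / sigma 2 P * x.2) := by
  have hs : 0 < √δ := Real.sqrt_pos.2 hδ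
  rw [← J_eq_conj (by positivity) (by positivity), envelope, mul_comm η]
  congr 2
  · field_simp
  · field_simp

lemma hasGrowth_envelope_scaled {q δ θ lam η ν : ℝ} {P : Measure ℝ} (hq : 0 < q) (hδ : 0 < δ)
    (hη : 0 < η) (hl : 0 ≤ lam) :
    HasGrowth (fun x => η * √δ * envelope q δ θ P lam η ν x) := by
  have hs : 0 < √δ := Real.sqrt_pos.2 hδ
  simp_rw [envelope_eq hδ hη hl]
  have h := ((hasGrowth_sub_mul_sq (√δ * (ν - η * θ) / sigma 2 P)).const_mul
    (2 * (√δ * η))⁻¹).add ((hasGrowth_conj (q := q) hq (by positivity : 0 < √δ * η)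
      (by positivity : 0 ≤ √δ * lam) (√δ * (ν - η * θ) / sigma 2 P)).const_mul (-1))
  refine h.mono fun x => le_of_eq ?_
  congr 1
  ring

lemma integrable_envelope {q δ θ lam η ν : ℝ} {P : ProbabilityMeasure ℝ} (hq : 0 < q) (hδ : 0 < δ)
    (hη : 0 < η) (hl : 0 ≤ lam) (hP2 : Integrable (fun x : ℝ => x ^ 2) (P : Measure ℝ)) :
    Integrable (envelope q δ θ (P : Measure ℝ) lam η ν)
      ((gaussianReal 0 1).prod (P : Measure ℝ)) := by
  have hs : 0 < √δ := Real.sqrt_pos.2 hδ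
  have hc : Continuous (fun x => η * √δ * envelope q δ θ (P : Measure ℝ) lam η ν x) := by
    simp_rw [envelope_eq hδ hη hl]
    have := continuous_conj (q := q) (η := √δ * η) (lam := √δ * lam) (by positivity)
      (by positivity)
    fun_prop
  have h := ((hasGrowth_envelope_scaled (P := (P : Measure ℝ)) (θ := θ) (ν := ν) hq hδ hη
    hl).integrable_prod hc hP2).const_mul (η * √δ)⁻¹
  refine h.congr (ae_of_all _ fun x => ?_)
  have : η * √δ ≠ 0 := by positivity
  field_simp

/-- The objective is the dual function, at rescaled and shifted multipliers. In particular its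
dependence on `δ` is spurious. -/
lemma objective_eq_dualValue {p q δ α θ ε₀ lam η ν : ℝ} {P : ProbabilityMeasure ℝ}
    (hq : 0 < q) (hδ : 0 < δ) (hη : 0 < η) (hl : 0 ≤ lam)
    (hP2 : Integrable (fun x : ℝ => x ^ 2) (P : Measure ℝ))
    (hP0 : 0 < sigma 2 (P : Measure ℝ)) :
    objective p q δ α θ ε₀ (P : Measure ℝ) lam η ν =
      dualValue q (α ^ 2 + θ ^ 2) ((ε₀ * sigma p (P : Measure ℝ)) ^ (-q)) θ
        (sigma 2 (P : Measure ℝ)) (P : Measure ℝ) (√δ * lam) (√δ * η) (√δ * (ν - η * θ)) := by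
  have hs : 0 < √δ := Real.sqrt_pos.2 hδ
  have hη' : 0 < √δ * η := by positivity
  have hl' : 0 ≤ √δ * lam := by positivity
  set c := √δ * (ν - η * θ) / sigma 2 (P : Measure ℝ) with hc
  have h1 : Integrable (fun x : ℝ × ℝ => (x.1 - c * x.2) ^ 2)
      ((gaussianReal 0 1).prod (P : Measure ℝ)) :=
    (hasGrowth_sub_mul_sq c).integrable_prod (by fun_prop) hP2
  have hcc := continuous_conj (q := q) hη' hl'
  have h2 : Integrable (fun x : ℝ × ℝ => conj q (√δ * η) (√δ * lam) (x.1 - c * x.2))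
      ((gaussianReal 0 1).prod (P : Measure ℝ)) :=
    (hasGrowth_conj hq hη' hl' c).integrable_prod (by fun_prop) hP2
  rw [objective, dualValue, ← integral_const_mul]
  simp_rw [envelope_eq hδ hη hl]
  rw [integral_sub (h1.div_const _) h2, integral_div, integral_sub_mul_sq hP2, ← sigma_two_sq]
  have hδ' : δ = √δ ^ 2 := (Real.sq_sqrt hδ.le).symm
  have hcσ : c ^ 2 * sigma 2 (P : Measure ℝ) ^ 2 = (√δ * (ν - η * θ)) ^ 2 := by
    rw [hc]; field_simp
  rw [hcσ]
  generalize (ε₀ * sigma p (P : Measure ℝ)) ^ (-q) = B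
  generalize ∫ x : ℝ × ℝ, conj q (√δ * η) (√δ * lam) (x.1 - c * x.2)
    ∂((gaussianReal 0 1).prod (P : Measure ℝ)) = I
  have h5 : √δ * (1 / (2 * η * δ)) = 1 / (2 * (√δ * η)) := by
    nth_rewrite 2 [hδ']; field_simp
  have h6 : √δ * (ν ^ 2 / (2 * η)) - (√δ * (ν - η * θ)) ^ 2 / (2 * (√δ * η)) =
      √δ * (ν * θ - η * θ ^ 2 / 2) := by field_simp; ring
  rw [add_div]
  linear_combination h5 + h6

/-! ### Duality for the limiting problem -/

section Bounded

variable (F : BoundedContinuousFunction (ℝ × ℝ) ℝ)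

lemma abs_bcf_le (x : ℝ × ℝ) : |F x| ≤ ‖F‖ := F.norm_coe_le_norm x

lemma abs_bcf_rpow_le {r : ℝ} (hr : 0 ≤ r) (x : ℝ × ℝ) : |F x| ^ r ≤ ‖F‖ ^ r :=
  Real.rpow_le_rpow (abs_nonneg _) (abs_bcf_le F x) hr

lemma continuous_abs_bcf_rpow {r : ℝ} (hr : 0 ≤ r) : Continuous (fun x => |F x| ^ r) :=
  (continuous_abs_rpow hr).comp F.continuous

lemma hasGrowth_abs_bcf_rpow {r : ℝ} (hr : 0 ≤ r) : HasGrowth (fun x => |F x| ^ r) :=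
  hasGrowth_of_bounded (‖F‖ ^ r) fun x => by
    rw [abs_of_nonneg (Real.rpow_nonneg (abs_nonneg _) _)]
    exact abs_bcf_rpow_le F hr x

lemma hasGrowth_bcf_mul {g : ℝ × ℝ → ℝ} (hg : HasGrowth g) : HasGrowth (fun x => F x * g x) :=
  hg.bounded_mul ‖F‖ (abs_bcf_le F)

variable {P : ProbabilityMeasure ℝ} (hP2 : Integrable (fun x : ℝ => x ^ 2) (P : Measure ℝ))
include hP2

lemma integrable_abs_bcf_rpow {r : ℝ} (hr : 0 ≤ r) :
    Integrable (fun x => |F x| ^ r) ((gaussianReal 0 1).prod (P : Measure ℝ)) :=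
  (hasGrowth_abs_bcf_rpow F hr).integrable_prod (continuous_abs_bcf_rpow F hr) hP2

lemma integrable_bcf_sq :
    Integrable (fun x => F x ^ 2) ((gaussianReal 0 1).prod (P : Measure ℝ)) := by
  simpa using integrable_abs_bcf_rpow F hP2 (r := 2) (by norm_num)

lemma integrable_bcf_mul_fst :
    Integrable (fun x => F x * x.1) ((gaussianReal 0 1).prod (P : Measure ℝ)) :=
  (hasGrowth_bcf_mul F hasGrowth_fst).integrable_prod (by fun_prop) hP2

lemma integrable_bcf_mul_snd :
    Integrable (fun x => F x * x.2) ((gaussianReal 0 1).prod (P : Measure ℝ)) :=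
  (hasGrowth_bcf_mul F hasGrowth_snd).integrable_prod (by fun_prop) hP2

lemma integrable_gain {q η lam : ℝ} (hq : 0 < q) (c : ℝ) :
    Integrable (fun x => gain q η lam (x.1 - c * x.2) (F x))
      ((gaussianReal 0 1).prod (P : Measure ℝ)) := by
  have h := ((((integrable_bcf_mul_fst F hP2).sub ((integrable_bcf_mul_snd F hP2).const_mul c)).sub
    ((integrable_bcf_sq F hP2).const_mul (η / 2))).sub
      ((integrable_abs_bcf_rpow F hP2 hq.le).const_mul lam))
  refine h.congr (ae_of_all _ fun x => ?_)
  simp only [gain, Pi.sub_apply]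
  ring

lemma integral_gain {q η lam : ℝ} (hq : 0 < q) (c : ℝ) :
    ∫ x, gain q η lam (x.1 - c * x.2) (F x) ∂((gaussianReal 0 1).prod (P : Measure ℝ)) =
      ∫ x, F x * x.1 ∂((gaussianReal 0 1).prod (P : Measure ℝ)) -
      c * ∫ x, F x * x.2 ∂((gaussianReal 0 1).prod (P : Measure ℝ)) -
      η / 2 * ∫ x, F x ^ 2 ∂((gaussianReal 0 1).prod (P : Measure ℝ)) -
      lam * ∫ x, |F x| ^ q ∂((gaussianReal 0 1).prod (P : Measure ℝ)) := by
  rw [← integral_const_mul, ← integral_const_mul, ← integral_const_mul,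
    ← integral_sub (integrable_bcf_mul_fst F hP2) ((integrable_bcf_mul_snd F hP2).const_mul c),
    ← integral_sub _ ((integrable_bcf_sq F hP2).const_mul (η / 2)),
    ← integral_sub _ ((integrable_abs_bcf_rpow F hP2 hq.le).const_mul lam)]
  · refine integral_congr_ae (ae_of_all _ fun x => ?_)
    simp only [gain]
    ring
  · exact ((integrable_bcf_mul_fst F hP2).sub ((integrable_bcf_mul_snd F hP2).const_mul c)).sub
      ((integrable_bcf_sq F hP2).const_mul (η / 2))
  · exact (integrable_bcf_mul_fst F hP2).sub ((integrable_bcf_mul_snd F hP2).const_mul c)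

end Bounded

/-- Pointwise maximization of the Lagrangian is asymptotically attained by bounded continuous
functions of `(h, M)`. -/
lemma exists_integral_gain_near {q η lam : ℝ} (hq : 1 < q) (hη : 0 < η) (hl : 0 ≤ lam) (c : ℝ)
    {P : ProbabilityMeasure ℝ} (hP2 : Integrable (fun x : ℝ => x ^ 2) (P : Measure ℝ))
    {ε : ℝ} (hε : 0 < ε) :
    ∃ F : BoundedContinuousFunction (ℝ × ℝ) ℝ,
      ∫ x, conj q η lam (x.1 - c * x.2) ∂((gaussianReal 0 1).prod (P : Measure ℝ)) - ε ≤
        ∫ x, gain q η lam (x.1 - c * x.2) (F x) ∂((gaussianReal 0 1).prod (P : Measure ℝ)) := by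
  have hq0 : 0 < q := by linarith
  -- competitors from a countable dense set, together with `0`, whose gain is `0`
  let s : ℕ → Finset ℝ := fun N =>
    insert 0 ((Finset.range N).image (TopologicalSpace.denseSeq ℝ))
  have hs : ∀ N, (s N).Nonempty := fun N => Finset.insert_nonempty _ _
  set mx : ℕ → ℝ → ℝ := fun N y => (s N).sup' (hs N) (gain q η lam y) with hmx
  have hcy : ∀ u, Continuous fun y => gain q η lam y u := fun u => by unfold gain; fun_prop
  have hmxc : ∀ N, Continuous (mx N) := fun N =>
    Continuous.finset_sup'_apply (hs N) fun u _ => hcy u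
  have hmx0 : ∀ N y, 0 ≤ mx N y := fun N y => by
    rw [← gain_zero (q := q) (η := η) (lam := lam) hq0 y]
    exact Finset.le_sup' (gain q η lam y) (Finset.mem_insert_self _ _)
  have hmx1 : ∀ N y, mx N y ≤ conj q η lam y := fun N y =>
    Finset.sup'_le _ _ fun u _ => gain_le_conj hη hl y u
  have hcc := continuous_conj (q := q) hη hl
  have hci : Integrable (fun x : ℝ × ℝ => conj q η lam (x.1 - c * x.2))
      ((gaussianReal 0 1).prod (P : Measure ℝ)) :=
    (hasGrowth_conj hq0 hη hl c).integrable_prod (by fun_prop) hP2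
  have hlim : ∀ y, Tendsto (fun N => mx N y) atTop (𝓝 (conj q η lam y)) := by
    intro y
    rw [tendsto_order]
    refine ⟨fun a ha => ?_, fun a ha => Eventually.of_forall fun N => (hmx1 N y).trans_lt ha⟩
    obtain ⟨u, hu⟩ := exists_lt_of_lt_ciSup ha
    obtain ⟨_, hk, ⟨k, rfl⟩⟩ := (TopologicalSpace.denseRange_denseSeq ℝ).inter_open_nonempty
      {u | a < gain q η lam y u} (isOpen_lt continuous_const (continuous_gain hq0 y)) ⟨u, hu⟩
    filter_upwards [eventually_gt_atTop k] with N hN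
    refine lt_of_lt_of_le hk (Finset.le_sup' (gain q η lam y) ?_)
    exact Finset.mem_insert_of_mem (Finset.mem_image_of_mem _ (Finset.mem_range.2 hN))
  have hmxi : ∀ N, Integrable (fun x : ℝ × ℝ => mx N (x.1 - c * x.2))
      ((gaussianReal 0 1).prod (P : Measure ℝ)) := fun N =>
    hci.mono' (((hmxc N).comp (by fun_prop)).aestronglyMeasurable) (ae_of_all _ fun x => by
      rw [Real.norm_of_nonneg (hmx0 N _)]
      exact hmx1 N _)
  have hL : Tendsto (fun N => ∫ x : ℝ × ℝ, mx N (x.1 - c * x.2)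
      ∂((gaussianReal 0 1).prod (P : Measure ℝ))) atTop
      (𝓝 (∫ x : ℝ × ℝ, conj q η lam (x.1 - c * x.2)
        ∂((gaussianReal 0 1).prod (P : Measure ℝ)))) := by
    refine tendsto_integral_of_dominated_convergence _
      (fun N => (hmxi N).aestronglyMeasurable) hci (fun N => ae_of_all _ fun x => ?_)
      (ae_of_all _ fun x => hlim _)
    rw [Real.norm_of_nonneg (hmx0 N _)]
    exact hmx1 N _
  obtain ⟨N, hN⟩ := ((tendsto_order.1 hL).1 _ (sub_lt_self _ (half_pos hε))).exists
  obtain ⟨φ, hφ⟩ := exists_continuous_near_max hq.le hη hl (hs N) (half_pos hε)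
  let F : BoundedContinuousFunction (ℝ × ℝ) ℝ :=
    φ.compContinuous ⟨fun x : ℝ × ℝ => x.1 - c * x.2, by fun_prop⟩
  refine ⟨F, ?_⟩
  have h1 : ∫ x : ℝ × ℝ, (mx N (x.1 - c * x.2) - ε / 2)
      ∂((gaussianReal 0 1).prod (P : Measure ℝ)) ≤
      ∫ x, gain q η lam (x.1 - c * x.2) (F x) ∂((gaussianReal 0 1).prod (P : Measure ℝ)) :=
    integral_mono ((hmxi N).sub (integrable_const _)) (integrable_gain F hP2 hq0 c)
      fun x => hφ _
  rw [integral_sub (hmxi N) (integrable_const _)] at h1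
  simp only [integral_const, probReal_univ, smul_eq_mul, one_mul] at h1
  linarith

/-- The tuples `(a, b, c, e)` with `E[F M] = a`, `E[F²] ≤ b`, `E|F|^q ≤ c` and `e ≤ E[F h]` for
some bounded continuous function `F` of `(h, M)`. -/
def attainable (q : ℝ) (P : Measure ℝ) : Set (ℝ × ℝ × ℝ × ℝ) :=
  {v | ∃ F : BoundedContinuousFunction (ℝ × ℝ) ℝ,
    ∫ x, F x * x.2 ∂((gaussianReal 0 1).prod P) = v.1 ∧
    ∫ x, F x ^ 2 ∂((gaussianReal 0 1).prod P) ≤ v.2.1 ∧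
    ∫ x, |F x| ^ q ∂((gaussianReal 0 1).prod P) ≤ v.2.2.1 ∧
    v.2.2.2 ≤ ∫ x, F x * x.1 ∂((gaussianReal 0 1).prod P)}

lemma convex_attainable {q : ℝ} (hq : 1 < q) {P : ProbabilityMeasure ℝ}
    (hP2 : Integrable (fun x : ℝ => x ^ 2) (P : Measure ℝ)) :
    Convex ℝ (attainable q (P : Measure ℝ)) := by
  rintro v ⟨F, h1, h2, h3, h4⟩ w ⟨G, k1, k2, k3, k4⟩ a b ha hb hab
  have hq0 : 0 ≤ q := by linarith
  refine ⟨a • F + b • G, ?_, ?_, ?_, ?_⟩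
  · simp only [BoundedContinuousFunction.coe_add, BoundedContinuousFunction.coe_smul,
      Pi.add_apply, smul_eq_mul, add_mul, mul_assoc, Prod.fst_add, Prod.smul_fst]
    rw [integral_add ((integrable_bcf_mul_snd F hP2).const_mul a)
      ((integrable_bcf_mul_snd G hP2).const_mul b), integral_const_mul, integral_const_mul, h1, k1]
  · have h : ∫ x, ((a • F + b • G) x) ^ 2 ∂((gaussianReal 0 1).prod (P : Measure ℝ)) ≤
        ∫ x, (a * F x ^ 2 + b * G x ^ 2) ∂((gaussianReal 0 1).prod (P : Measure ℝ)) := by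
      refine integral_mono (integrable_bcf_sq _ hP2) (((integrable_bcf_sq F hP2).const_mul a).add
        ((integrable_bcf_sq G hP2).const_mul b)) fun x => ?_
      exact (even_two.convexOn_pow).2 (Set.mem_univ (F x)) (Set.mem_univ (G x)) ha hb hab
    refine h.trans ?_
    rw [integral_add ((integrable_bcf_sq F hP2).const_mul a)
      ((integrable_bcf_sq G hP2).const_mul b), integral_const_mul, integral_const_mul]
    exact add_le_add (mul_le_mul_of_nonneg_left h2 ha) (mul_le_mul_of_nonneg_left k2 hb)
  · have h : ∫ x, |(a • F + b • G) x| ^ q ∂((gaussianReal 0 1).prod (P : Measure ℝ)) ≤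
        ∫ x, (a * |F x| ^ q + b * |G x| ^ q) ∂((gaussianReal 0 1).prod (P : Measure ℝ)) := by
      refine integral_mono (integrable_abs_bcf_rpow _ hP2 hq0)
        (((integrable_abs_bcf_rpow F hP2 hq0).const_mul a).add
        ((integrable_abs_bcf_rpow G hP2 hq0).const_mul b)) fun x => ?_
      exact (abs_rpow_convexOn hq.le).2 (Set.mem_univ (F x)) (Set.mem_univ (G x)) ha hb hab
    refine h.trans ?_
    rw [integral_add ((integrable_abs_bcf_rpow F hP2 hq0).const_mul a)
      ((integrable_abs_bcf_rpow G hP2 hq0).const_mul b), integral_const_mul, integral_const_mul]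
    exact add_le_add (mul_le_mul_of_nonneg_left h3 ha) (mul_le_mul_of_nonneg_left k3 hb)
  · simp only [BoundedContinuousFunction.coe_add, BoundedContinuousFunction.coe_smul,
      Pi.add_apply, smul_eq_mul, add_mul, mul_assoc]
    rw [integral_add ((integrable_bcf_mul_fst F hP2).const_mul a)
      ((integrable_bcf_mul_fst G hP2).const_mul b), integral_const_mul, integral_const_mul]
    exact add_le_add (mul_le_mul_of_nonneg_left h4 ha) (mul_le_mul_of_nonneg_left k4 hb)

/-- Young's inequality with `E[h²] = 1`. -/
lemma integral_bcf_mul_fst_le (F : BoundedContinuousFunction (ℝ × ℝ) ℝ)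
    {P : ProbabilityMeasure ℝ} (hP2 : Integrable (fun x : ℝ => x ^ 2) (P : Measure ℝ)) :
    ∫ x, F x * x.1 ∂((gaussianReal 0 1).prod (P : Measure ℝ)) ≤
      1 / 2 * ∫ x, F x ^ 2 ∂((gaussianReal 0 1).prod (P : Measure ℝ)) + 1 / 2 := by
  have h1 : Integrable (fun x : ℝ × ℝ => x.1 ^ 2) ((gaussianReal 0 1).prod (P : Measure ℝ)) :=
    hasGrowth_fst_sq.integrable_prod (by fun_prop) hP2
  have h : ∫ x, F x * x.1 ∂((gaussianReal 0 1).prod (P : Measure ℝ)) ≤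
      ∫ x, (1 / 2 * F x ^ 2 + 1 / 2 * x.1 ^ 2) ∂((gaussianReal 0 1).prod (P : Measure ℝ)) :=
    integral_mono (integrable_bcf_mul_fst F hP2)
      (((integrable_bcf_sq F hP2).const_mul _).add (h1.const_mul _)) fun x => by
        dsimp only
        nlinarith [sq_nonneg (F x - x.1)]
  rw [integral_add ((integrable_bcf_sq F hP2).const_mul _) (h1.const_mul _), integral_const_mul,
    integral_const_mul, integral_fun_fst (fun h : ℝ => h ^ 2), integral_fst_sq_gaussian] at h
  simpa using h

/-- Strong duality, up to an arbitrarily small violation of the constraints. A strictly separating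
functional need not involve the objective or the second moment, so a small `t > 0` is added to
both of its coefficients; dividing by the coefficient of the objective then gives admissible
multipliers. -/
lemma mem_closure_attainable {q A B θ σ D : ℝ} (hq : 1 < q) (hσ : 0 < σ)
    {P : ProbabilityMeasure ℝ} (hP2 : Integrable (fun x : ℝ => x ^ 2) (P : Measure ℝ))
    (hD : ∀ lam η ν, 0 ≤ lam → 0 < η → D ≤ dualValue q A B θ σ (P : Measure ℝ) lam η ν) :
    (θ * σ, A, B, D) ∈ closure (attainable q (P : Measure ℝ)) := by
  by_contra hy
  obtain ⟨f, u, hfu, huf⟩ := geometric_hahn_banach_closed_point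
    (convex_attainable hq hP2).closure isClosed_closure hy
  have hq0 : 0 < q := by linarith
  obtain ⟨f1, f2, f3, f4, hf⟩ : ∃ f1 f2 f3 f4 : ℝ, ∀ a b c e : ℝ,
      f (a, b, c, e) = f1 * a + f2 * b + f3 * c + f4 * e := by
    refine ⟨f (1, 0, 0, 0), f (0, 1, 0, 0), f (0, 0, 1, 0), f (0, 0, 0, 1), fun a b c e => ?_⟩
    have : ((a, b, c, e) : ℝ × ℝ × ℝ × ℝ) = a • (1, 0, 0, 0) + b • (0, 1, 0, 0) +
        c • (0, 0, 1, 0) + e • (0, 0, 0, 1) := by simp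
    rw [this]
    simp only [map_add, map_smul, smul_eq_mul]
    ring
  have hC : ∀ v ∈ attainable q (P : Measure ℝ), f v < u := fun v hv => hfu v (subset_closure hv)
  -- the attainable set recedes in the directions in which the constraints are relaxed, which
  -- fixes the signs of `f2`, `f3` and `f4`
  have hrec : ∀ b c e : ℝ, 0 ≤ b → 0 ≤ c → 0 ≤ e → f2 * b + f3 * c - f4 * e < u := by
    intro b c e hb hc he
    have h := hC (0, b, c, -e) ⟨0, by simp, by simpa using hb,
      by simpa [Real.zero_rpow hq0.ne'] using hc, by simpa using he⟩
    rw [hf] at h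
    linarith
  have hu0 : 0 < u := by simpa using hrec 0 0 0 le_rfl le_rfl le_rfl
  have h2 : f2 ≤ 0 := by
    by_contra! h
    have := hrec (u / f2) 0 0 (by positivity) le_rfl le_rfl
    rw [mul_div_cancel₀ _ h.ne'] at this
    linarith
  have h3 : f3 ≤ 0 := by
    by_contra! h
    have := hrec 0 (u / f3) 0 le_rfl (by positivity) le_rfl
    rw [mul_div_cancel₀ _ h.ne'] at this
    linarith
  have h4 : 0 ≤ f4 := by
    by_contra! h
    have := hrec 0 0 (u / (-f4)) le_rfl le_rfl (div_nonneg hu0.le (by linarith))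
    have h' : f4 * (u / (-f4)) = -u := by
      have : f4 ≠ 0 := h.ne
      field_simp
    linarith
  rw [hf] at huf
  -- `g` is the margin of the separation, and `t` is so small that the perturbation keeps it
  set g := f1 * (θ * σ) + f2 * A + f3 * B + f4 * D - u with hg
  have hg0 : 0 < g := by linarith
  set κ := |(A + 1) / 2 - D| + 1 with hκ
  have hκ0 : 0 < κ := by positivity
  set t := g / (2 * κ) with ht
  have ht0 : 0 < t := by positivity
  have htk : t * ((A + 1) / 2 - D) < g := by
    have h1 : t * ((A + 1) / 2 - D) ≤ t * κ :=
      mul_le_mul_of_nonneg_left (by linarith [le_abs_self ((A + 1) / 2 - D)]) ht0.le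
    have h2 : t * κ = g / 2 := by rw [ht]; field_simp
    linarith
  set e := f4 + t with he
  have he0 : 0 < e := by linarith
  set η := (-2 * f2 + t) / e with hη
  have hη0 : 0 < η := div_pos (by linarith) he0
  set lam := -f3 / e with hlam
  have hlam0 : 0 ≤ lam := div_nonneg (by linarith) he0.le
  set c := -f1 / e with hc
  have hcon : ∫ x, conj q η lam (x.1 - c * x.2) ∂((gaussianReal 0 1).prod (P : Measure ℝ)) ≤
      (u + t / 2) / e := by
    refine le_of_forall_pos_le_add fun ε hε => ?_
    obtain ⟨F, hF⟩ := exists_integral_gain_near hq hη0 hlam0 c hP2 hε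
    rw [integral_gain F hP2 hq0 c] at hF
    have h5 := hC (_, _, _, _) ⟨F, rfl, le_rfl, le_rfl, le_rfl⟩
    rw [hf] at h5
    have h6 := integral_bcf_mul_fst_le F hP2
    generalize ∫ x, F x * x.1 ∂((gaussianReal 0 1).prod (P : Measure ℝ)) = e' at *
    generalize ∫ x, F x * x.2 ∂((gaussianReal 0 1).prod (P : Measure ℝ)) = a' at *
    generalize ∫ x, F x ^ 2 ∂((gaussianReal 0 1).prod (P : Measure ℝ)) = b' at *
    generalize ∫ x, |F x| ^ q ∂((gaussianReal 0 1).prod (P : Measure ℝ)) = c' at *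
    have h7 : e' - c * a' - η / 2 * b' - lam * c' =
        (f1 * a' + f2 * b' + f3 * c' + f4 * e' + t * (e' - b' / 2)) / e := by
      rw [hc, hη, hlam]
      field_simp
      ring
    have h8 : (f1 * a' + f2 * b' + f3 * c' + f4 * e' + t * (e' - b' / 2)) / e ≤
        (u + t / 2) / e := by
      refine div_le_div_of_nonneg_right ?_ he0.le
      have : t * (e' - b' / 2) ≤ t * (1 / 2) := mul_le_mul_of_nonneg_left (by linarith) ht0.le
      linarith
    linarith
  have h9 := hD lam η (c * σ) hlam0 hη0
  rw [dualValue, mul_div_assoc, div_self hσ.ne', mul_one] at h9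
  have h10 : D ≤ c * σ * θ + η / 2 * A + lam * B + (u + t / 2) / e := by linarith
  have h11 : c * σ * θ + η / 2 * A + lam * B + (u + t / 2) / e =
      (-(f1 * (θ * σ)) - f2 * A + t / 2 * A - f3 * B + u + t / 2) / e := by
    rw [hc, hη, hlam]
    field_simp
    ring
  rw [h11, le_div_iff₀ he0] at h10
  rw [he] at h10
  linarith

/-! ### Strictly feasible functions by symmetrization -/

/-- The midpoint convexity gap of `|·|^r`. -/
noncomputable def gap (r a b : ℝ) : ℝ := (|a| ^ r + |b| ^ r) / 2 - |(a + b) / 2| ^ r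

lemma gap_nonneg {r : ℝ} (hr : 1 ≤ r) (a b : ℝ) : 0 ≤ gap r a b := by
  have h := (abs_rpow_convexOn hr).2 (Set.mem_univ a) (Set.mem_univ b)
    (by norm_num : (0 : ℝ) ≤ 1 / 2) (by norm_num : (0 : ℝ) ≤ 1 / 2) (by norm_num)
  simp only [smul_eq_mul] at h
  rw [← mul_add, one_div_mul_eq_div] at h
  unfold gap
  linarith

lemma gap_pos {r : ℝ} (hr : 1 < r) {a b : ℝ} (hab : a ≠ b) : 0 < gap r a b := by
  have hr0 : 0 < r := by linarith
  have h1 : |(a + b) / 2| ^ r ≤ ((|a| + |b|) / 2) ^ r := by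
    refine Real.rpow_le_rpow (abs_nonneg _) ?_ hr0.le
    rw [abs_div, abs_two]
    linarith [abs_add_le a b]
  unfold gap
  by_cases h : |a| = |b|
  · rcases abs_eq_abs.1 h with h' | h'
    · exact absurd h' hab
    · have hb : b ≠ 0 := fun h0 => hab (by simp [h', h0])
      have : 0 < |b| ^ r := Real.rpow_pos_of_pos (abs_pos.2 hb) r
      rw [h', neg_add_cancel, zero_div, abs_zero, Real.zero_rpow hr0.ne', abs_neg]
      linarith
  · have h2 := (strictConvexOn_rpow hr).2 (Set.mem_Ici.2 (abs_nonneg a))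
      (Set.mem_Ici.2 (abs_nonneg b)) h (by norm_num : (0 : ℝ) < 1 / 2)
      (by norm_num : (0 : ℝ) < 1 / 2) (by norm_num)
    simp only [smul_eq_mul] at h2
    rw [← mul_add, one_div_mul_eq_div] at h2
    linarith

lemma continuous_gap {r : ℝ} (hr : 0 ≤ r) : Continuous (fun p : ℝ × ℝ => gap r p.1 p.2) := by
  have h := continuous_abs_rpow hr
  unfold gap
  exact (((h.comp continuous_fst).add (h.comp continuous_snd)).div_const 2).sub
    (h.comp (by fun_prop : Continuous fun p : ℝ × ℝ => (p.1 + p.2) / 2))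

/-- Uniform strict convexity of `|·|^r` in a form that can be integrated: apart from small moment
terms, a correlation of the difference `a - b` is paid for by the convexity gap. -/
lemma exists_sub_mul_le_gap {r : ℝ} (hr : 1 < r) {s : ℝ} (hs : 0 < s) :
    ∃ K, 0 < K ∧ ∀ a b h : ℝ, (a - b) * h ≤ s * (1 + a ^ 2 + b ^ 2 + h ^ 4) + K * gap r a b := by
  set t := s / 2 with ht
  have ht0 : 0 < t := by positivity
  -- `L` is what is left of `h² / (2 t)` after subtracting `t h⁴`; outside the square of radius `R`
  -- it is absorbed by `t (a² + b²)`, inside by the gap, unless `|a - b| < t`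
  set L := 1 / (16 * t ^ 3) with hL
  have hL0 : 0 < L := by positivity
  set R := L / t + 1 with hR
  have hR1 : 1 ≤ R := by rw [hR]; linarith [div_pos hL0 ht0]
  have hR2 : L ≤ t * R ^ 2 := by
    have h1 : L = t * (L / t) := by field_simp
    rw [h1]
    refine mul_le_mul_of_nonneg_left ?_ ht0.le
    nlinarith
  let S : Set (ℝ × ℝ) := {p | |p.1| ≤ R ∧ |p.2| ≤ R ∧ t ≤ |p.1 - p.2|}
  have hS : IsCompact S := by
    refine (isCompact_Icc.prod isCompact_Icc).of_isClosed_subset (s := Set.Icc (-R) R ×ˢ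
      Set.Icc (-R) R) ?_ fun p hp => ⟨abs_le.1 hp.1, abs_le.1 hp.2.1⟩
    have c1 : Continuous fun p : ℝ × ℝ => |p.1| := by fun_prop
    have c2 : Continuous fun p : ℝ × ℝ => |p.2| := by fun_prop
    have c3 : Continuous fun p : ℝ × ℝ => |p.1 - p.2| := by fun_prop
    exact (isClosed_le c1 continuous_const).inter
      ((isClosed_le c2 continuous_const).inter (isClosed_le continuous_const c3))
  obtain ⟨c, hc0, hc⟩ : ∃ c, 0 < c ∧ ∀ p ∈ S, c ≤ gap r p.1 p.2 := by
    rcases S.eq_empty_or_nonempty with h | h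
    · exact ⟨1, one_pos, by simp [h]⟩
    · obtain ⟨p, hp, hmin⟩ := hS.exists_isMinOn h
        (continuous_gap (by linarith : 0 ≤ r)).continuousOn
      refine ⟨gap r p.1 p.2, gap_pos hr fun h0 => ?_, fun x hx => hmin hx⟩
      have := hp.2.2
      rw [h0, sub_self, abs_zero] at this
      linarith
  refine ⟨L / c, by positivity, fun a b h => ?_⟩
  have hg := gap_nonneg hr.le a b
  have hKg : 0 ≤ L / c * gap r a b := by positivity
  have hst : s = 2 * t := by rw [ht]; ring
  rw [hst]
  have h4 : 0 ≤ h ^ 4 := by positivity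
  rcases lt_or_ge |a - b| t with h1 | h1
  · have h2 : (a - b) * h ≤ t * |h| := by
      refine (le_abs_self _).trans ?_
      rw [abs_mul]
      exact mul_le_mul_of_nonneg_right h1.le (abs_nonneg _)
    have h3 : |h| ≤ 1 + h ^ 4 := by
      have : h ^ 4 = |h| ^ 4 := by rw [← abs_pow, abs_of_nonneg h4]
      rw [this]
      nlinarith [sq_nonneg (|h| ^ 2 - 1), sq_nonneg (|h| - 1), abs_nonneg h]
    nlinarith [mul_le_mul_of_nonneg_left h3 ht0.le, mul_nonneg ht0.le (sq_nonneg a),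
      mul_nonneg ht0.le (sq_nonneg b), mul_nonneg ht0.le h4]
  · -- Young's inequality, twice
    have h2 : (a - b) * h ≤ t * (a ^ 2 + b ^ 2) + h ^ 2 / (2 * t) := by
      have : t * (a ^ 2 + b ^ 2) + h ^ 2 / (2 * t) - (a - b) * h =
          (t * (a - b) - h) ^ 2 / (2 * t) + t / 2 * (a + b) ^ 2 := by field_simp; ring
      have h' : 0 ≤ (t * (a - b) - h) ^ 2 / (2 * t) + t / 2 * (a + b) ^ 2 := by positivity
      linarith
    have h3 : h ^ 2 / (2 * t) ≤ t * h ^ 4 + L := by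
      have : t * h ^ 4 + L - h ^ 2 / (2 * t) = t * (h ^ 2 - 1 / (4 * t ^ 2)) ^ 2 := by
        rw [hL]; field_simp; ring
      have h' : 0 ≤ t * (h ^ 2 - 1 / (4 * t ^ 2)) ^ 2 := by positivity
      linarith
    have hta := mul_nonneg ht0.le (sq_nonneg a)
    have htb := mul_nonneg ht0.le (sq_nonneg b)
    have hth := mul_nonneg ht0.le h4
    by_cases hin : |a| ≤ R ∧ |b| ≤ R
    · have h5 := hc (a, b) ⟨hin.1, hin.2, h1⟩
      have h6 : L ≤ L / c * gap r a b := by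
        rw [div_mul_eq_mul_div, le_div_iff₀ hc0]
        exact mul_le_mul_of_nonneg_left h5 hL0.le
      linarith
    · have h5 : R ^ 2 ≤ a ^ 2 + b ^ 2 := by
        rw [not_and_or, not_le, not_le] at hin
        rcases hin with h | h
        · have : R ^ 2 ≤ |a| ^ 2 := by gcongr
          rw [sq_abs] at this
          linarith [sq_nonneg b]
        · have : R ^ 2 ≤ |b| ^ 2 := by gcongr
          rw [sq_abs] at this
          linarith [sq_nonneg a]
      have h6 := mul_le_mul_of_nonneg_left h5 ht0.le
      linarith

lemma abs_add_rpow_le {r : ℝ} (hr : 1 ≤ r) (a b : ℝ) :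
    |a + b| ^ r ≤ 2 ^ r / 2 * (|a| ^ r + |b| ^ r) := by
  have h := gap_nonneg hr (2 * a) (2 * b)
  unfold gap at h
  rw [← mul_add, mul_div_cancel_left₀ _ two_ne_zero, abs_mul, abs_mul, abs_two,
    Real.mul_rpow zero_le_two (abs_nonneg _), Real.mul_rpow zero_le_two (abs_nonneg _)] at h
  linarith

/-- Effect of adding a small multiple `c * b` to `a`, by convexity. -/
lemma abs_add_mul_rpow_le {r : ℝ} (hr : 1 ≤ r) (a b : ℝ) {c : ℝ} (hc : |c| ≤ 1) :
    |a + c * b| ^ r ≤ |a| ^ r + |c| * (2 ^ r * (|a| ^ r + |b| ^ r)) := by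
  have key : ∀ (e b : ℝ), 0 ≤ e → e ≤ 1 →
      |a + e * b| ^ r ≤ |a| ^ r + e * (2 ^ r * (|a| ^ r + |b| ^ r)) := by
    intro e b he he1
    have h := (abs_rpow_convexOn hr).2 (Set.mem_univ a) (Set.mem_univ (a + b))
      (sub_nonneg.2 he1) he (by ring)
    simp only [smul_eq_mul] at h
    have h1 : (1 - e) * a + e * (a + b) = a + e * b := by ring
    rw [h1] at h
    have h2 := mul_le_mul_of_nonneg_left (abs_add_rpow_le hr a b) he
    have h3 : 0 ≤ |a| ^ r := Real.rpow_nonneg (abs_nonneg _) _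
    have h4 : 0 ≤ |b| ^ r := Real.rpow_nonneg (abs_nonneg _) _
    have h5 : 0 ≤ e * (2 ^ r / 2 * (|a| ^ r + |b| ^ r)) := by positivity
    nlinarith [mul_nonneg he h3]
  rcases le_total 0 c with h0 | h0
  · rw [abs_of_nonneg h0] at hc ⊢
    exact key c b h0 hc
  · rw [abs_of_nonpos h0] at hc ⊢
    have := key (-c) (-b) (by linarith) hc
    rwa [neg_mul_neg, abs_neg] at this

section Symmetrization

variable {P : ProbabilityMeasure ℝ}

/-- The law of `(h, M)` is invariant under `h ↦ -h`. -/
lemma measurePreserving_neg_fst : MeasurePreserving (fun x : ℝ × ℝ => (-x.1, x.2))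
    ((gaussianReal 0 1).prod (P : Measure ℝ)) ((gaussianReal 0 1).prod (P : Measure ℝ)) := by
  have h : MeasurePreserving (fun x : ℝ => -x) (gaussianReal 0 1) (gaussianReal 0 1) :=
    ⟨measurable_neg, by rw [gaussianReal_map_neg, neg_zero]⟩
  exact h.prod (MeasurePreserving.id _)

lemma integral_comp_neg_fst {f : ℝ × ℝ → ℝ} (hf : Continuous f) :
    ∫ x : ℝ × ℝ, f (-x.1, x.2) ∂((gaussianReal 0 1).prod (P : Measure ℝ)) =
      ∫ x, f x ∂((gaussianReal 0 1).prod (P : Measure ℝ)) := by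
  have h := measurePreserving_neg_fst (P := P)
  conv_rhs => rw [← h.map_eq]
  rw [integral_map h.measurable.aemeasurable hf.aestronglyMeasurable]

/-- The function `(h, M) ↦ F (-h, M)`. -/
noncomputable def reflect (F : BoundedContinuousFunction (ℝ × ℝ) ℝ) :
    BoundedContinuousFunction (ℝ × ℝ) ℝ :=
  F.compContinuous ⟨fun x : ℝ × ℝ => (-x.1, x.2), by fun_prop⟩

@[simp] lemma reflect_apply (F : BoundedContinuousFunction (ℝ × ℝ) ℝ) (x : ℝ × ℝ) :
    reflect F x = F (-x.1, x.2) := rfl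

lemma integral_abs_reflect_rpow (F : BoundedContinuousFunction (ℝ × ℝ) ℝ) {r : ℝ} (hr : 0 ≤ r) :
    ∫ x, |reflect F x| ^ r ∂((gaussianReal 0 1).prod (P : Measure ℝ)) =
      ∫ x, |F x| ^ r ∂((gaussianReal 0 1).prod (P : Measure ℝ)) :=
  integral_comp_neg_fst (continuous_abs_bcf_rpow F hr)

lemma integral_reflect_mul_snd (F : BoundedContinuousFunction (ℝ × ℝ) ℝ) :
    ∫ x, reflect F x * x.2 ∂((gaussianReal 0 1).prod (P : Measure ℝ)) =
      ∫ x, F x * x.2 ∂((gaussianReal 0 1).prod (P : Measure ℝ)) :=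
  integral_comp_neg_fst (f := fun x => F x * x.2) (by fun_prop)

lemma integral_reflect_mul_fst (F : BoundedContinuousFunction (ℝ × ℝ) ℝ) :
    ∫ x, reflect F x * x.1 ∂((gaussianReal 0 1).prod (P : Measure ℝ)) =
      -∫ x, F x * x.1 ∂((gaussianReal 0 1).prod (P : Measure ℝ)) := by
  rw [← integral_comp_neg_fst (f := fun x => F x * x.1) (by fun_prop), ← integral_neg]
  refine integral_congr_ae (ae_of_all _ fun x => ?_)
  simp

variable (hP2 : Integrable (fun x : ℝ => x ^ 2) (P : Measure ℝ))
include hP2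

lemma integrable_gap_reflect (F : BoundedContinuousFunction (ℝ × ℝ) ℝ) {r : ℝ} (hr : 0 ≤ r) :
    Integrable (fun x => gap r (F x) (reflect F x))
      ((gaussianReal 0 1).prod (P : Measure ℝ)) := by
  have h := (((integrable_abs_bcf_rpow F hP2 hr).add
    (integrable_abs_bcf_rpow (reflect F) hP2 hr)).div_const 2).sub
    (integrable_abs_bcf_rpow ((1 / 2 : ℝ) • (F + reflect F)) hP2 hr)
  refine h.congr (ae_of_all _ fun x => ?_)
  simp only [gap, Pi.sub_apply, Pi.add_apply, BoundedContinuousFunction.coe_add,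
    BoundedContinuousFunction.coe_smul, smul_eq_mul, one_div_mul_eq_div]

/-- Moving `F` towards its symmetrization decreases the `r`-th moment by a multiple of the
convexity gap; the perturbation by `c χ` is of first order in `c`. -/
lemma integral_abs_symmetrize_rpow_le (F χ : BoundedContinuousFunction (ℝ × ℝ) ℝ) {r : ℝ}
    (hr : 1 < r) {s c : ℝ} (hs : 0 ≤ s) (hs1 : s ≤ 1) (hc : |c| ≤ 1) :
    ∫ x, |((1 - s) • F + s • ((1 / 2 : ℝ) • (F + reflect F)) + c • χ) x| ^ r
        ∂((gaussianReal 0 1).prod (P : Measure ℝ)) ≤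
      ∫ x, |F x| ^ r ∂((gaussianReal 0 1).prod (P : Measure ℝ)) -
      s * ∫ x, gap r (F x) (reflect F x) ∂((gaussianReal 0 1).prod (P : Measure ℝ)) +
      |c| * (2 ^ r * (∫ x, |F x| ^ r ∂((gaussianReal 0 1).prod (P : Measure ℝ)) +
        ∫ x, |χ x| ^ r ∂((gaussianReal 0 1).prod (P : Measure ℝ)))) := by
  have hr0 : 0 ≤ r := by linarith
  have i1 := integrable_abs_bcf_rpow F hP2 hr0
  have i2 := integrable_abs_bcf_rpow (reflect F) hP2 hr0
  have i3 := integrable_abs_bcf_rpow χ hP2 hr0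
  have i4 := integrable_gap_reflect hP2 F hr0
  have i5 : Integrable (fun x => (1 - s) * |F x| ^ r + s / 2 * (|F x| ^ r + |reflect F x| ^ r))
      ((gaussianReal 0 1).prod (P : Measure ℝ)) :=
    (i1.const_mul _).add ((i1.add i2).const_mul _)
  have i6 : Integrable (fun x => (1 - s) * |F x| ^ r + s / 2 * (|F x| ^ r + |reflect F x| ^ r) +
      |χ x| ^ r) ((gaussianReal 0 1).prod (P : Measure ℝ)) := i5.add i3
  have i7 : Integrable (fun x => (1 - s) * |F x| ^ r + s / 2 * (|F x| ^ r + |reflect F x| ^ r) -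
      s * gap r (F x) (reflect F x)) ((gaussianReal 0 1).prod (P : Measure ℝ)) :=
    i5.sub (i4.const_mul s)
  have e5 : ∫ x, ((1 - s) * |F x| ^ r + s / 2 * (|F x| ^ r + |reflect F x| ^ r))
      ∂((gaussianReal 0 1).prod (P : Measure ℝ)) =
      ∫ x, |F x| ^ r ∂((gaussianReal 0 1).prod (P : Measure ℝ)) := by
    have i12 : Integrable (fun x => |F x| ^ r + |reflect F x| ^ r)
        ((gaussianReal 0 1).prod (P : Measure ℝ)) := i1.add i2
    rw [integral_add (i1.const_mul _) (i12.const_mul _), integral_const_mul,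
      integral_const_mul, integral_add i1 i2, integral_abs_reflect_rpow F hr0]
    ring
  have hpt : ∀ x, |((1 - s) • F + s • ((1 / 2 : ℝ) • (F + reflect F)) + c • χ) x| ^ r ≤
      (1 - s) * |F x| ^ r + s / 2 * (|F x| ^ r + |reflect F x| ^ r) -
        s * gap r (F x) (reflect F x) + |c| * 2 ^ r * ((1 - s) * |F x| ^ r +
          s / 2 * (|F x| ^ r + |reflect F x| ^ r) + |χ x| ^ r) := by
    intro x
    set a := F x
    set b := reflect F x
    have h1 : ((1 - s) • F + s • ((1 / 2 : ℝ) • (F + reflect F)) + c • χ) x =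
        ((1 - s) * a + s * ((a + b) / 2)) + c * χ x := by
      simp only [BoundedContinuousFunction.coe_add, BoundedContinuousFunction.coe_smul,
        Pi.add_apply, smul_eq_mul, one_div_mul_eq_div, a, b]
    rw [h1]
    have h2 := abs_add_mul_rpow_le hr.le ((1 - s) * a + s * ((a + b) / 2)) (χ x) hc
    have h3 := (abs_rpow_convexOn hr.le).2 (Set.mem_univ a) (Set.mem_univ ((a + b) / 2))
      (sub_nonneg.2 hs1) hs (by ring)
    simp only [smul_eq_mul] at h3
    have h4 : |(a + b) / 2| ^ r = (|a| ^ r + |b| ^ r) / 2 - gap r a b := by unfold gap; ring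
    rw [h4] at h3
    have h5 : |(1 - s) * a + s * ((a + b) / 2)| ^ r ≤
        (1 - s) * |a| ^ r + s / 2 * (|a| ^ r + |b| ^ r) - s * gap r a b := by linarith
    have h6 : |(1 - s) * a + s * ((a + b) / 2)| ^ r ≤
        (1 - s) * |a| ^ r + s / 2 * (|a| ^ r + |b| ^ r) := by
      linarith [mul_nonneg hs (gap_nonneg hr.le a b)]
    have h7 : |c| * (2 ^ r * (|(1 - s) * a + s * ((a + b) / 2)| ^ r + |χ x| ^ r)) ≤
        |c| * 2 ^ r * ((1 - s) * |a| ^ r + s / 2 * (|a| ^ r + |b| ^ r) + |χ x| ^ r) := by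
      rw [← mul_assoc]
      gcongr
    linarith
  refine (integral_mono (integrable_abs_bcf_rpow _ hP2 hr0)
    (i7.add (i6.const_mul _)) hpt).trans (le_of_eq ?_)
  simp only [Pi.add_apply]
  rw [integral_add i7 (i6.const_mul _), integral_sub i5 (i4.const_mul s), integral_const_mul,
    integral_const_mul, integral_add i5 i3, e5]
  ring

end Symmetrization

/-- A bounded function correlated with `M`, used to correct the linear constraint. -/
lemma exists_correlated {P : ProbabilityMeasure ℝ}
    (hP2 : Integrable (fun x : ℝ => x ^ 2) (P : Measure ℝ))
    (hP0 : 0 < ∫ x, x ^ 2 ∂(P : Measure ℝ)) :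
    ∃ χ : BoundedContinuousFunction ℝ ℝ, ∫ m, χ m * m ∂(P : Measure ℝ) = 1 := by
  have hden : ∀ m : ℝ, 0 < 1 + m ^ 2 := fun m => by positivity
  let χ : BoundedContinuousFunction ℝ ℝ := BoundedContinuousFunction.ofNormedAddCommGroup
    (fun m => m / (1 + m ^ 2)) (by
      refine continuous_id.div (by fun_prop) fun m => (hden m).ne') 1 (fun m => by
      rw [norm_div, Real.norm_eq_abs, Real.norm_of_nonneg (hden m).le, div_le_one (hden m)]
      nlinarith [sq_nonneg (|m| - 1), sq_abs m])
  have hχ : ∀ m, χ m * m = m ^ 2 / (1 + m ^ 2) := fun m => by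
    change m / (1 + m ^ 2) * m = _
    ring
  have hi : Integrable (fun m => χ m * m) (P : Measure ℝ) := by
    refine hP2.mono' (by fun_prop) (ae_of_all _ fun m => ?_)
    rw [hχ, Real.norm_of_nonneg (by positivity)]
    exact div_le_self (sq_nonneg m) (by nlinarith [sq_nonneg m])
  have hpos : 0 < ∫ m, χ m * m ∂(P : Measure ℝ) := by
    have hnn : ∀ m, 0 ≤ χ m * m := fun m => by rw [hχ]; positivity
    refine lt_of_le_of_ne (integral_nonneg hnn) fun h => hP0.ne' ?_
    rw [eq_comm, integral_eq_zero_iff_of_nonneg hnn hi] at h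
    refine integral_eq_zero_of_ae ?_
    filter_upwards [h] with m hm
    rw [hχ] at hm
    simpa [(hden m).ne'] using hm
  refine ⟨(∫ m, χ m * m ∂(P : Measure ℝ))⁻¹ • χ, ?_⟩
  simp only [BoundedContinuousFunction.coe_smul, smul_eq_mul, mul_assoc]
  rw [integral_const_mul, inv_mul_cancel₀ hpos.ne']

/-- If the dual value is positive then the limiting problem has nearly optimal solutions for which
both inequality constraints are strict. A nearly optimal `F` is correlated with `h`, hence differs
from its reflection, so that averaging the two gains in both strictly convex constraints. -/
lemma exists_strictly_feasible {q A B θ σ D D₁ : ℝ} (hq : 1 < q) (hA : 0 ≤ A) (hσ : 0 < σ)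
    {P : ProbabilityMeasure ℝ} (hP2 : Integrable (fun x : ℝ => x ^ 2) (P : Measure ℝ))
    (hP0 : 0 < ∫ x, x ^ 2 ∂(P : Measure ℝ))
    (hD : ∀ lam η ν, 0 ≤ lam → 0 < η → D ≤ dualValue q A B θ σ (P : Measure ℝ) lam η ν)
    (hD0 : 0 < D) (hD1 : D₁ < D) :
    ∃ F : BoundedContinuousFunction (ℝ × ℝ) ℝ,
      ∫ x, F x * x.2 ∂((gaussianReal 0 1).prod (P : Measure ℝ)) = θ * σ ∧
      ∫ x, F x ^ 2 ∂((gaussianReal 0 1).prod (P : Measure ℝ)) < A ∧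
      ∫ x, |F x| ^ q ∂((gaussianReal 0 1).prod (P : Measure ℝ)) < B ∧
      D₁ < ∫ x, F x * x.1 ∂((gaussianReal 0 1).prod (P : Measure ℝ)) := by
  have hq0 : 0 ≤ q := by linarith
  obtain ⟨χ₀, hχ₀⟩ := exists_correlated hP2 hP0
  let χ : BoundedContinuousFunction (ℝ × ℝ) ℝ := χ₀.compContinuous ⟨Prod.snd, continuous_snd⟩
  have hχ : ∫ x, χ x * x.2 ∂((gaussianReal 0 1).prod (P : Measure ℝ)) = 1 := by
    have := integral_fun_snd (μ := gaussianReal 0 1) (ν := (P : Measure ℝ)) (fun m => χ₀ m * m)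
    simp only [probReal_univ, one_smul, hχ₀] at this
    exact this
  have hχh : ∫ x, χ x * x.1 ∂((gaussianReal 0 1).prod (P : Measure ℝ)) = 0 := by
    refine Eq.trans ?_ (integral_fst_mul_comp_snd (P := P) χ₀)
    exact integral_congr_ae (ae_of_all _ fun x : ℝ × ℝ => mul_comm (χ₀ x.2) x.1)
  set μ4 := ∫ x : ℝ × ℝ, x.1 ^ 4 ∂((gaussianReal 0 1).prod (P : Measure ℝ)) with hμ4
  have hμ40 : 0 ≤ μ4 := integral_nonneg fun x => by positivity
  have i4 : Integrable (fun x : ℝ × ℝ => x.1 ^ 4) ((gaussianReal 0 1).prod (P : Measure ℝ)) :=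
    hasGrowth_fst_pow_four.integrable_prod (by fun_prop) hP2
  -- chosen such that the moment terms of `exists_sub_mul_le_gap` have mean at most `D / 2`
  set s₀ := D / (2 * (1 + 2 * (A + 1) + μ4)) with hs₀
  have hs₀0 : 0 < s₀ := by positivity
  -- the convexity gap is bounded below, uniformly over nearly feasible functions
  have hgap : ∀ r, 1 < r → ∃ κ, 0 < κ ∧ ∀ F : BoundedContinuousFunction (ℝ × ℝ) ℝ,
      ∫ x, F x ^ 2 ∂((gaussianReal 0 1).prod (P : Measure ℝ)) ≤ A + 1 →
      D / 2 ≤ ∫ x, F x * x.1 ∂((gaussianReal 0 1).prod (P : Measure ℝ)) →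
      κ ≤ ∫ x, gap r (F x) (reflect F x) ∂((gaussianReal 0 1).prod (P : Measure ℝ)) := by
    intro r hr
    obtain ⟨K, hK0, hK⟩ := exists_sub_mul_le_gap hr hs₀0
    refine ⟨D / (2 * K), by positivity, fun F hF2 hFh => ?_⟩
    have j1 := integrable_bcf_mul_fst F hP2
    have j2 := integrable_bcf_mul_fst (reflect F) hP2
    have j3 := integrable_bcf_sq F hP2
    have j4 := integrable_bcf_sq (reflect F) hP2
    have j5 := integrable_gap_reflect hP2 F (by linarith : 0 ≤ r)
    have j34 : Integrable (fun x => F x ^ 2 + reflect F x ^ 2)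
        ((gaussianReal 0 1).prod (P : Measure ℝ)) := j3.add j4
    have j344 : Integrable (fun x => F x ^ 2 + reflect F x ^ 2 + x.1 ^ 4)
        ((gaussianReal 0 1).prod (P : Measure ℝ)) := j34.add i4
    have j6 : Integrable (fun x => 1 + (F x ^ 2 + reflect F x ^ 2 + x.1 ^ 4))
        ((gaussianReal 0 1).prod (P : Measure ℝ)) := (integrable_const 1).add j344
    have hsq : ∫ x, reflect F x ^ 2 ∂((gaussianReal 0 1).prod (P : Measure ℝ)) =
        ∫ x, F x ^ 2 ∂((gaussianReal 0 1).prod (P : Measure ℝ)) :=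
      integral_comp_neg_fst (f := fun x => F x ^ 2) (by fun_prop)
    have h1 : ∫ x, (F x * x.1 - reflect F x * x.1) ∂((gaussianReal 0 1).prod (P : Measure ℝ)) ≤
        ∫ x, (s₀ * (1 + (F x ^ 2 + reflect F x ^ 2 + x.1 ^ 4)) +
          K * gap r (F x) (reflect F x)) ∂((gaussianReal 0 1).prod (P : Measure ℝ)) := by
      refine integral_mono (j1.sub j2) ((j6.const_mul _).add (j5.const_mul _)) fun x => ?_
      have := hK (F x) (reflect F x) x.1
      dsimp only
      linarith
    rw [integral_sub j1 j2, integral_reflect_mul_fst, integral_add (j6.const_mul _)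
      (j5.const_mul _), integral_const_mul, integral_const_mul, integral_add (integrable_const 1)
      j344, integral_add j34 i4, integral_add j3 j4, hsq, ← hμ4] at h1
    simp only [integral_const, probReal_univ, smul_eq_mul, one_mul] at h1
    have h2 : s₀ * (1 + (∫ x, F x ^ 2 ∂((gaussianReal 0 1).prod (P : Measure ℝ)) +
        ∫ x, F x ^ 2 ∂((gaussianReal 0 1).prod (P : Measure ℝ)) + μ4)) ≤ D / 2 := by
      have : s₀ * (1 + 2 * (A + 1) + μ4) = D / 2 := by rw [hs₀]; field_simp
      rw [← this]
      refine mul_le_mul_of_nonneg_left ?_ hs₀0.le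
      linarith
    rw [div_le_iff₀ (by positivity)]
    linarith
  obtain ⟨κ2, hκ2, hgap2⟩ := hgap 2 one_lt_two
  obtain ⟨κq, hκq, hgapq⟩ := hgap q hq
  -- the step towards the symmetrization reduces the objective to about `(1 - s) D > D₁`
  set s := (D - max D₁ 0) / (2 * D) with hs
  have hmax : 0 < D - max D₁ 0 := sub_pos.2 (max_lt hD1 hD0)
  have hs0 : 0 < s := by positivity
  have hs1 : s ≤ 1 := by
    rw [hs, div_le_one (by positivity)]
    linarith [le_max_right D₁ 0]
  have hsD : (1 - s) * D = D - (D - max D₁ 0) / 2 := by rw [hs]; field_simp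
  set X2 := ∫ x, |χ x| ^ (2 : ℝ) ∂((gaussianReal 0 1).prod (P : Measure ℝ)) with hX2
  set Xq := ∫ x, |χ x| ^ q ∂((gaussianReal 0 1).prod (P : Measure ℝ)) with hXq
  have hX20 : 0 ≤ X2 := integral_nonneg fun x => Real.rpow_nonneg (abs_nonneg _) _
  have hXq0 : 0 ≤ Xq := integral_nonneg fun x => Real.rpow_nonneg (abs_nonneg _) _
  set L2 := 1 + 2 ^ (2 : ℝ) * (A + 1 + X2) with hL2
  have hL20 : 0 < L2 := by positivity
  set Lq := 1 + 2 ^ q * (|B| + 1 + Xq) with hLq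
  have hLq0 : 0 < Lq := by positivity
  -- the violation `ε` and the correction of the linear constraint cost at most `ε L2` and `ε Lq`,
  -- which has to be less than the gains `s κ2` and `s κq`
  obtain ⟨ε, hε0, hε⟩ : ∃ ε > 0, ε < 1 ∧ ε < D / 2 ∧ ε < (D - max D₁ 0) / 2 ∧
      ε < s * κ2 / L2 ∧ ε < s * κq / Lq := by
    set b := min 1 (min (D / 2) (min ((D - max D₁ 0) / 2) (min (s * κ2 / L2) (s * κq / Lq))))
      with hb
    have hb0 : 0 < b := by
      refine lt_min one_pos (lt_min (by positivity) (lt_min (by positivity) (lt_min ?_ ?_))) <;>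
      positivity
    have := half_lt_self hb0
    refine ⟨b / 2, half_pos hb0, ?_⟩
    rw [← lt_min_iff, ← lt_min_iff, ← lt_min_iff, ← lt_min_iff]
    exact this
  obtain ⟨hε1, hε2, hε3, hε4, hε5⟩ := hε
  rw [lt_div_iff₀ hL20] at hε4
  rw [lt_div_iff₀ hLq0] at hε5
  obtain ⟨v, ⟨F, hv1, hv2, hv3, hv4⟩, hdist⟩ := Metric.mem_closure_iff.1
    (mem_closure_attainable hq hσ hP2 hD) ε hε0
  simp only [Prod.dist_eq, Real.dist_eq, max_lt_iff, abs_lt] at hdist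
  obtain ⟨⟨d1, d1'⟩, ⟨d2, d2'⟩, ⟨d3, d3'⟩, ⟨d4, d4'⟩⟩ := hdist
  have hF2 : ∫ x, F x ^ 2 ∂((gaussianReal 0 1).prod (P : Measure ℝ)) ≤ A + ε := by linarith
  have hFq : ∫ x, |F x| ^ q ∂((gaussianReal 0 1).prod (P : Measure ℝ)) ≤ B + ε := by linarith
  have hFh : D - ε ≤ ∫ x, F x * x.1 ∂((gaussianReal 0 1).prod (P : Measure ℝ)) := by linarith
  -- the multiple of `χ` that restores the linear constraint
  set c := θ * σ - ∫ x, F x * x.2 ∂((gaussianReal 0 1).prod (P : Measure ℝ)) with hc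
  have hcε : |c| < ε := abs_lt.2 ⟨by linarith, by linarith⟩
  have hc1 : |c| ≤ 1 := by linarith
  have hg2 := hgap2 F (by linarith) (by linarith)
  have hgq := hgapq F (by linarith) (by linarith)
  have hsq : ∀ G : BoundedContinuousFunction (ℝ × ℝ) ℝ,
      ∫ x, |G x| ^ (2 : ℝ) ∂((gaussianReal 0 1).prod (P : Measure ℝ)) =
        ∫ x, G x ^ 2 ∂((gaussianReal 0 1).prod (P : Measure ℝ)) := fun G => by simp
  have m2 := integral_abs_symmetrize_rpow_le hP2 F χ one_lt_two hs0.le hs1 hc1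
  have mq := integral_abs_symmetrize_rpow_le hP2 F χ hq hs0.le hs1 hc1
  have happ : ∀ x, ((1 - s) • F + s • ((1 / 2 : ℝ) • (F + reflect F)) + c • χ) x =
      (1 - s / 2) * F x + s / 2 * reflect F x + c * χ x := fun x => by
    simp only [BoundedContinuousFunction.coe_add, BoundedContinuousFunction.coe_smul,
      Pi.add_apply, smul_eq_mul]
    ring
  refine ⟨(1 - s) • F + s • ((1 / 2 : ℝ) • (F + reflect F)) + c • χ, ?_, ?_, ?_, ?_⟩
  · simp_rw [happ, add_mul, mul_assoc]
    have k1 := (integrable_bcf_mul_snd F hP2).const_mul (1 - s / 2)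
    have k2 := (integrable_bcf_mul_snd (reflect F) hP2).const_mul (s / 2)
    have k3 := (integrable_bcf_mul_snd χ hP2).const_mul c
    have k12 : Integrable (fun x => (1 - s / 2) * (F x * x.2) + s / 2 * (reflect F x * x.2))
      ((gaussianReal 0 1).prod (P : Measure ℝ)) := k1.add k2
    rw [integral_add k12 k3, integral_add k1 k2, integral_const_mul, integral_const_mul,
      integral_const_mul, integral_reflect_mul_snd, hχ, hc]
    ring
  · rw [hsq, hsq F] at m2
    rw [← hX2] at m2
    have h1 : |c| * (2 ^ (2 : ℝ) * (∫ x, F x ^ 2 ∂((gaussianReal 0 1).prod (P : Measure ℝ)) + X2))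
        ≤ ε * (2 ^ (2 : ℝ) * (A + 1 + X2)) := by
      gcongr
      linarith
    have h2 := mul_le_mul_of_nonneg_left hg2 hs0.le
    rw [hL2] at hε4
    linarith
  · rw [← hXq] at mq
    have h1 : |c| * (2 ^ q * (∫ x, |F x| ^ q ∂((gaussianReal 0 1).prod (P : Measure ℝ)) + Xq))
        ≤ ε * (2 ^ q * (|B| + 1 + Xq)) := by
      gcongr
      linarith [le_abs_self B]
    have h2 := mul_le_mul_of_nonneg_left hgq hs0.le
    rw [hLq] at hε5
    linarith
  · simp_rw [happ, add_mul, mul_assoc]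
    have k1 := (integrable_bcf_mul_fst F hP2).const_mul (1 - s / 2)
    have k2 := (integrable_bcf_mul_fst (reflect F) hP2).const_mul (s / 2)
    have k3 := (integrable_bcf_mul_fst χ hP2).const_mul c
    have k12 : Integrable (fun x => (1 - s / 2) * (F x * x.1) + s / 2 * (reflect F x * x.1))
      ((gaussianReal 0 1).prod (P : Measure ℝ)) := k1.add k2
    rw [integral_add k12 k3, integral_add k1 k2, integral_const_mul, integral_const_mul,
      integral_const_mul, integral_reflect_mul_fst, hχh]
    have h1 : (1 - s) * (D - ε) ≤
        (1 - s) * ∫ x, F x * x.1 ∂((gaussianReal 0 1).prod (P : Measure ℝ)) :=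
      mul_le_mul_of_nonneg_left hFh (by linarith)
    have h2 : (1 - s) * ε ≤ ε := mul_le_of_le_one_left hε0.le (by linarith)
    linarith [le_max_left D₁ 0]

/-! ### The constraint set in normalized coordinates -/

lemma inner_eq_sum {d : ℕ} (x y : EuclideanSpace ℝ (Fin d)) : inner ℝ x y = ∑ i, x i * y i := by
  rw [PiLp.inner_apply]
  exact Finset.sum_congr rfl fun i _ => by simp [mul_comm]

lemma norm_toLp_eq {d : ℕ} (hd : 0 < d) (g : Fin d → ℝ) :
    ‖(WithLp.toLp 2 g : EuclideanSpace ℝ (Fin d))‖ = √d * √(avg (fun i => g i ^ 2)) := by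
  have hd' : (d : ℝ) ≠ 0 := by positivity
  rw [EuclideanSpace.norm_eq, ← Real.sqrt_mul (by positivity), avg, ← mul_assoc,
    mul_inv_cancel₀ hd', one_mul]
  simp

lemma norm_eq_sqrt_avg {d : ℕ} (hd : 0 < d) (μ : EuclideanSpace ℝ (Fin d)) :
    ‖μ‖ = √(avg (fun i => (√d * μ i) ^ 2)) := by
  have hd' : (d : ℝ) ≠ 0 := by positivity
  have h : ∀ i, (√(d : ℝ) * μ i) ^ 2 = d * μ i ^ 2 := fun i => by
    rw [mul_pow, Real.sq_sqrt (by positivity)]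
  simp_rw [h]
  rw [EuclideanSpace.norm_eq, avg, ← Finset.mul_sum, ← mul_assoc, inv_mul_cancel₀ hd', one_mul]
  simp

lemma ellNorm_eq {d : ℕ} (hd : 0 < d) {r : ℝ} (hr : 0 < r) (x : Fin d → ℝ) :
    ellNorm r x = (d : ℝ) ^ (1 / r - 1 / 2) * (avg (fun i => |√d * x i| ^ r)) ^ (1 / r) := by
  have hd' : (0 : ℝ) < d := by positivity
  have h : ∀ i, |√(d : ℝ) * x i| ^ r = (d : ℝ) ^ (r / 2) * |x i| ^ r := fun i => by
    rw [abs_mul, abs_of_nonneg (Real.sqrt_nonneg _), Real.mul_rpow (Real.sqrt_nonneg _)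
      (abs_nonneg _), Real.sqrt_eq_rpow, ← Real.rpow_mul hd'.le]
    congr 2
    ring
  have hs : 0 ≤ ∑ i, |x i| ^ r :=
    Finset.sum_nonneg fun i _ => Real.rpow_nonneg (abs_nonneg _) _
  simp_rw [h]
  rw [ellNorm, avg, ← Finset.mul_sum, ← mul_assoc, Real.mul_rpow (by positivity) hs,
    ← mul_assoc]
  have h2 : (d : ℝ) ^ (1 / r - 1 / 2) * ((d : ℝ)⁻¹ * (d : ℝ) ^ (r / 2)) ^ (1 / r) = 1 := by
    rw [← Real.rpow_neg_one, ← Real.rpow_add hd', ← Real.rpow_mul hd'.le, ← Real.rpow_add hd']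
    have : 1 / r - 1 / 2 + (-1 + r / 2) * (1 / r) = 0 := by field_simp; ring
    rw [this, Real.rpow_zero]
  rw [h2, one_mul]

/-- The constraint set in the coordinates `W i = √d (z i + θ μ i / ‖μ‖)`. -/
lemma mem_constraintSet_iff {d : ℕ} (hd : 0 < d) {p q α θ ε₀ : ℝ} (hpq : p.HolderConjugate q)
    (hα : 0 ≤ α) (hε₀ : 0 < ε₀) {μ z : EuclideanSpace ℝ (Fin d)} (hμ : 0 < ‖μ‖)
    (hμp : 0 < avg (fun i => |√d * μ i| ^ p)) {W : Fin d → ℝ}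
    (hW : ∀ i, W i = √d * (z i + θ * (μ i / ‖μ‖))) :
    z ∈ constraintSet p q α θ ε₀ μ ↔
      avg (fun i => W i * (√d * μ i)) = θ * ‖μ‖ ∧ avg (fun i => W i ^ 2) ≤ α ^ 2 + θ ^ 2 ∧
      avg (fun i => |W i| ^ q) ≤ (ε₀ * (avg (fun i => |√d * μ i| ^ p)) ^ (1 / p)) ^ (-q) := by
  have hd' : (0 : ℝ) < d := by positivity
  have hss : √(d : ℝ) * √(d : ℝ) = d := Real.mul_self_sqrt hd'.le
  have hμ2 : ∑ i, μ i * μ i = ‖μ‖ ^ 2 := by rw [← inner_eq_sum, real_inner_self_eq_norm_sq]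
  have hz2 : ∑ i, z i * z i = ‖z‖ ^ 2 := by rw [← inner_eq_sum, real_inner_self_eq_norm_sq]
  have h1 : avg (fun i => W i * (√d * μ i)) = inner ℝ z μ + θ * ‖μ‖ := by
    have : ∀ i, W i * (√d * μ i) = d * (z i * μ i + θ / ‖μ‖ * (μ i * μ i)) := fun i => by
      rw [hW]; linear_combination (z i * μ i + θ / ‖μ‖ * (μ i * μ i)) * hss
    simp_rw [this]
    rw [avg_const_mul, avg, ← mul_assoc, mul_inv_cancel₀ hd'.ne', one_mul,
      Finset.sum_add_distrib, ← Finset.mul_sum, hμ2, inner_eq_sum]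
    field_simp
  have h2 : avg (fun i => W i ^ 2) = ‖z‖ ^ 2 + 2 * θ / ‖μ‖ * inner ℝ z μ + θ ^ 2 := by
    have : ∀ i, W i ^ 2 = d * (z i * z i + 2 * θ / ‖μ‖ * (z i * μ i) +
        (θ / ‖μ‖) ^ 2 * (μ i * μ i)) := fun i => by
      rw [hW]
      linear_combination (z i * z i + 2 * θ / ‖μ‖ * (z i * μ i) +
        (θ / ‖μ‖) ^ 2 * (μ i * μ i)) * hss
    simp_rw [this]
    rw [avg_const_mul, avg, ← mul_assoc, mul_inv_cancel₀ hd'.ne', one_mul,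
      Finset.sum_add_distrib, Finset.sum_add_distrib, ← Finset.mul_sum, ← Finset.mul_sum, hμ2,
      hz2, inner_eq_sum]
    field_simp
  have hp0 := hpq.pos
  have hq0 := hpq.symm.pos
  set mp := (avg (fun i => |√d * μ i| ^ p)) ^ (1 / p) with hmp
  have hmp0 : 0 < mp := Real.rpow_pos_of_pos hμp _
  have h3 : ellNorm q (fun i => z i + θ * (μ i / ‖μ‖)) ≤ 1 / (ε₀ * ellNorm p (fun i => μ i)) ↔
      avg (fun i => |W i| ^ q) ≤ (ε₀ * mp) ^ (-q) := by
    rw [ellNorm_eq hd hq0, ellNorm_eq hd hp0]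
    simp_rw [← hW]
    rw [← hmp]
    have ha : 0 ≤ avg (fun i => |W i| ^ q) :=
      avg_nonneg fun i => Real.rpow_nonneg (abs_nonneg _) _
    set a := avg (fun i => |W i| ^ q)
    have hdd : (d : ℝ) ^ (1 / q - 1 / 2) * (d : ℝ) ^ (1 / p - 1 / 2) = 1 := by
      rw [← Real.rpow_add hd']
      have := hpq.inv_add_inv_eq_one
      rw [show 1 / q - 1 / 2 + (1 / p - 1 / 2) = 0 by linear_combination this,
        Real.rpow_zero]
    have hd1 : 0 < (d : ℝ) ^ (1 / p - 1 / 2) := Real.rpow_pos_of_pos hd' _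
    rw [le_div_iff₀ (by positivity)]
    have : (d : ℝ) ^ (1 / q - 1 / 2) * a ^ (1 / q) * (ε₀ * ((d : ℝ) ^ (1 / p - 1 / 2) * mp)) =
        a ^ (1 / q) * (ε₀ * mp) := by
      linear_combination (a ^ (1 / q) * (ε₀ * mp)) * hdd
    rw [this, ← le_div_iff₀ (by positivity), Real.rpow_neg (by positivity),
      ← Real.inv_rpow (by positivity), one_div, one_div, Real.rpow_inv_le_iff_of_pos ha
        (by positivity) hq0]
  have hdef : z ∈ constraintSet p q α θ ε₀ μ ↔ inner ℝ z μ = 0 ∧ ‖z‖ ≤ α ∧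
      ellNorm q (fun i => z i + θ * (μ i / ‖μ‖)) ≤ 1 / (ε₀ * ellNorm p (fun i => μ i)) := Iff.rfl
  rw [hdef, h3, h1, h2]
  have hiff : inner ℝ z μ + θ * ‖μ‖ = θ * ‖μ‖ ↔ inner ℝ z μ = 0 := by simp
  rw [hiff]
  refine and_congr_right fun h0 => and_congr_left fun _ => ?_
  rw [h0, mul_zero, add_zero, add_le_add_iff_right, pow_le_pow_iff_left₀ (norm_nonneg _) hα
    two_ne_zero]

lemma inner_toLp_eq {d : ℕ} (hd : 0 < d) {θ : ℝ} {μ z : EuclideanSpace ℝ (Fin d)} {W : Fin d → ℝ}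
    (hW : ∀ i, W i = √d * (z i + θ * (μ i / ‖μ‖))) (g : Fin d → ℝ) :
    inner ℝ z (WithLp.toLp 2 g) =
      √d * (avg (fun i => W i * g i) - θ / ‖μ‖ * avg (fun i => √d * μ i * g i)) := by
  have hd' : (0 : ℝ) < d := by positivity
  have hss : √(d : ℝ) * √(d : ℝ) = d := Real.mul_self_sqrt hd'.le
  rw [← avg_const_mul, ← avg_sub, ← avg_const_mul, inner_eq_sum, avg, Finset.mul_sum]
  refine Finset.sum_congr rfl fun i _ => ?_
  have : √(d : ℝ) * (W i * g i - θ / ‖μ‖ * (√d * μ i * g i)) = d * (z i * g i) := by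
    rw [hW]; linear_combination (z i * g i) * hss
  rw [this, ← mul_assoc, inv_mul_cancel₀ hd'.ne', one_mul]

/-! ### The support function -/

/-- The support function `x ↦ sup_{z ∈ S} ⟨z, x⟩`. -/
noncomputable def supportFn {d : ℕ} (S : Set (EuclideanSpace ℝ (Fin d)))
    (x : EuclideanSpace ℝ (Fin d)) : ℝ :=
  sSup ((fun z => inner ℝ z x) '' S)

section Support

variable {d : ℕ} {S : Set (EuclideanSpace ℝ (Fin d))} {α : ℝ}

open scoped Pointwise in
lemma supportFn_smul {r : ℝ} (hr : 0 < r) (x : EuclideanSpace ℝ (Fin d)) :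
    supportFn S (r • x) = r * supportFn S x := by
  have h : (fun z => inner ℝ z (r • x)) '' S = r • ((fun z => inner ℝ z x) '' S) := by
    ext y
    simp [Set.mem_smul_set, inner_smul_right]
  rw [supportFn, supportFn, h, Real.sSup_smul_of_nonneg hr.le, smul_eq_mul]

lemma supportFn_le (hS : S.Nonempty) {x : EuclideanSpace ℝ (Fin d)} {C : ℝ}
    (h : ∀ z ∈ S, inner ℝ z x ≤ C) : supportFn S x ≤ C :=
  csSup_le (hS.image _) (by rintro _ ⟨z, hz, rfl⟩; exact h z hz)

variable (hSα : ∀ z ∈ S, ‖z‖ ≤ α)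
include hSα

lemma inner_le_of_mem {z : EuclideanSpace ℝ (Fin d)} (hz : z ∈ S) (x : EuclideanSpace ℝ (Fin d)) :
    inner ℝ z x ≤ α * ‖x‖ :=
  (real_inner_le_norm z x).trans (mul_le_mul_of_nonneg_right (hSα z hz) (norm_nonneg _))

lemma inner_le_supportFn {z : EuclideanSpace ℝ (Fin d)} (hz : z ∈ S)
    (x : EuclideanSpace ℝ (Fin d)) : inner ℝ z x ≤ supportFn S x :=
  le_csSup ⟨α * ‖x‖, by rintro _ ⟨w, hw, rfl⟩; exact inner_le_of_mem hSα hw x⟩ ⟨z, hz, rfl⟩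

variable (hS : S.Nonempty)
include hS

lemma abs_supportFn_le (x : EuclideanSpace ℝ (Fin d)) : |supportFn S x| ≤ α * ‖x‖ := by
  obtain ⟨z, hz⟩ := hS
  refine abs_le.2 ⟨?_, supportFn_le ⟨z, hz⟩ fun z hz => inner_le_of_mem hSα hz x⟩
  have h1 := inner_le_supportFn hSα hz x
  have h2 := inner_le_of_mem hSα hz (-x)
  rw [inner_neg_right, norm_neg] at h2
  linarith

lemma continuous_supportFn : Continuous (supportFn S) := by
  have hα : 0 ≤ α := hS.elim fun z hz => (norm_nonneg z).trans (hSα z hz)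
  have key : ∀ x y, supportFn S x ≤ supportFn S y + α * dist x y := fun x y => by
    refine supportFn_le hS fun z hz => ?_
    have h1 := inner_le_supportFn hSα hz y
    have h2 := inner_le_of_mem hSα hz (x - y)
    rw [inner_sub_right] at h2
    rw [dist_eq_norm]
    linarith
  exact (LipschitzWith.of_le_add_mul ⟨α, hα⟩ key).continuous

end Support

lemma integrable_sq_apply_gaussianVec {d : ℕ} (i : Fin d) :
    Integrable (fun g : Fin d → ℝ => g i ^ 2) (gaussianVec d) :=
  integrable_comp_apply_gaussianVec i (f := fun h => h ^ 2) (integrable_pow_gaussian 2)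

lemma abs_sqrt_sub_one_le {x : ℝ} (hx : 0 ≤ x) : |√x - 1| ≤ |x - 1| := by
  have h : x - 1 = (√x - 1) * (√x + 1) := by
    nth_rewrite 1 [← Real.sq_sqrt hx]; ring
  rw [h, abs_mul]
  refine le_mul_of_one_le_right (abs_nonneg _) ?_
  rw [abs_of_nonneg (by positivity)]
  linarith [Real.sqrt_nonneg x]

lemma integrable_sqrt_avg_sq {d : ℕ} :
    Integrable (fun g : Fin d → ℝ => √(avg (fun i => g i ^ 2))) (gaussianVec d) := by
  have h : Integrable (fun g : Fin d → ℝ => avg (fun i => g i ^ 2)) (gaussianVec d) :=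
    integrable_avg integrable_sq_apply_gaussianVec
  refine ((integrable_const 1).add h).mono'
    h.aestronglyMeasurable.aemeasurable.sqrt.aestronglyMeasurable
    (ae_of_all _ fun g => ?_)
  have h0 : 0 ≤ avg (fun i => g i ^ 2) := avg_nonneg fun i => sq_nonneg _
  rw [Real.norm_of_nonneg (Real.sqrt_nonneg _)]
  change _ ≤ 1 + avg (fun i => g i ^ 2)
  nlinarith [Real.sq_sqrt h0, Real.sqrt_nonneg (avg fun i => g i ^ 2),
    sq_nonneg (√(avg fun i => g i ^ 2) - 1)]

lemma integrable_supportFn {d : ℕ} (hd : 0 < d) {S : Set (EuclideanSpace ℝ (Fin d))} {α : ℝ}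
    (hSα : ∀ z ∈ S, ‖z‖ ≤ α) (hS : S.Nonempty) :
    Integrable (fun g => supportFn S (WithLp.toLp 2 g)) (gaussianVec d) := by
  have hc := continuous_supportFn hSα hS
  refine (integrable_sqrt_avg_sq.const_mul (α * √d)).mono'
    (hc.comp (PiLp.continuous_toLp 2 _)).aestronglyMeasurable (ae_of_all _ fun g => ?_)
  refine (abs_supportFn_le hSα hS _).trans (le_of_eq ?_)
  rw [norm_toLp_eq hd, mul_assoc]

/-- The spherical width as a ratio of Gaussian means, both normalized by `√d`. -/
lemma sphericalWidth_eq {d : ℕ} (hd : 0 < d) (S : Set (EuclideanSpace ℝ (Fin d)))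
    (hne : ∫ g : Fin d → ℝ, √(avg (fun i => g i ^ 2)) ∂(gaussianVec d) ≠ 0) :
    sphericalWidth S = (∫ g, supportFn S (WithLp.toLp 2 g) / √d ∂(gaussianVec d)) /
      ∫ g : Fin d → ℝ, √(avg (fun i => g i ^ 2)) ∂(gaussianVec d) := by
  have hd' : √(d : ℝ) ≠ 0 := (Real.sqrt_pos.2 (by positivity)).ne'
  have h := sphere_average_eq hd (supportFn S) (fun r x hr => supportFn_smul hr x)
  simp_rw [norm_toLp_eq hd] at h
  rw [integral_const_mul] at h
  rw [integral_div, div_div, ← h (mul_ne_zero hd' hne)]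
  rfl

/-- The normalized mean norm of a standard Gaussian vector converges to one. -/
lemma tendsto_integral_sqrt_avg_sq {d : ℕ → ℕ} (hd : Tendsto (fun n => (d n : ℝ)) atTop atTop)
    {v : ∀ n, Fin (d n) → ℝ} {P : ProbabilityMeasure ℝ}
    (hweak : Tendsto (fun n => empirical (v n)) atTop (𝓝 P.toFiniteMeasure))
    (hP2 : Integrable (fun x : ℝ => x ^ 2) (P : Measure ℝ))
    (hmom : Tendsto (fun n => avg (fun i => v n i ^ 2)) atTop
      (𝓝 (∫ x, x ^ 2 ∂(P : Measure ℝ)))) :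
    Tendsto (fun n => ∫ g : Fin (d n) → ℝ, √(avg (fun i => g i ^ 2)) ∂(gaussianVec (d n))) atTop
      (𝓝 1) := by
  have hg4 : HasGrowth (fun x : ℝ × ℝ => (x.1 ^ 2) ^ 2) := by
    simpa only [← pow_mul] using hasGrowth_fst_pow_four
  have h := tendsto_integral_abs_avg_sub hd hweak hP2 hmom (f := fun x => x.1 ^ 2) (by fun_prop)
    hasGrowth_fst_sq hg4
  have he : ∫ x : ℝ × ℝ, x.1 ^ 2 ∂((gaussianReal 0 1).prod (P : Measure ℝ)) = 1 := by
    rw [integral_fun_fst (fun h : ℝ => h ^ 2), integral_fst_sq_gaussian]; simp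
  rw [he] at h
  rw [tendsto_iff_norm_sub_tendsto_zero]
  refine squeeze_zero (fun n => norm_nonneg _) (fun n => ?_) h
  have h1 : ∫ g : Fin (d n) → ℝ, √(avg (fun i => g i ^ 2)) ∂(gaussianVec (d n)) - 1 =
      ∫ g : Fin (d n) → ℝ, (√(avg (fun i => g i ^ 2)) - 1) ∂(gaussianVec (d n)) := by
    rw [integral_sub integrable_sqrt_avg_sq (integrable_const _)]; simp
  rw [h1]
  have h2 : Integrable (fun g : Fin (d n) → ℝ => avg (fun i => g i ^ 2)) (gaussianVec (d n)) :=
    integrable_avg integrable_sq_apply_gaussianVec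
  refine norm_integral_le_of_norm_le (h2.sub (integrable_const 1)).norm (ae_of_all _ fun g => ?_)
  exact abs_sqrt_sub_one_le (avg_nonneg fun i => sq_nonneg _)

/-! ### Gaussian means of the support function -/

section FixedDimension

variable {d : ℕ} {p q α θ ε₀ : ℝ} {μ : EuclideanSpace ℝ (Fin d)}

lemma norm_le_of_mem_constraintSet :
    ∀ z ∈ constraintSet p q α θ ε₀ μ, ‖z‖ ≤ α := fun _ hz => hz.2.1

lemma integral_avg_mul_gaussianVec (x : Fin d → ℝ) :
    ∫ g : Fin d → ℝ, avg (fun i => x i * g i) ∂(gaussianVec d) = 0 := by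
  have hi : ∀ i, Integrable (fun g : Fin d → ℝ => x i * g i) (gaussianVec d) := fun i =>
    (integrable_comp_apply_gaussianVec i (f := fun h => h)
      (by simpa using integrable_pow_gaussian 1)).const_mul _
  rw [integral_avg hi]
  have : ∀ i, ∫ g : Fin d → ℝ, x i * g i ∂(gaussianVec d) = 0 := fun i => by
    rw [integral_const_mul, integral_comp_apply_gaussianVec i (f := fun h => h) continuous_id,
      integral_id_gaussianReal, mul_zero]
  simp [this, avg]

lemma integrable_avg_mul_gaussianVec (x : Fin d → ℝ) :
    Integrable (fun g : Fin d → ℝ => avg (fun i => x i * g i)) (gaussianVec d) :=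
  integrable_avg fun i => (integrable_comp_apply_gaussianVec i (f := fun h => h)
      (by simpa using integrable_pow_gaussian 1)).const_mul _

/-- The support function dominates a single linear functional, which has mean zero. -/
lemma integral_supportFn_nonneg (hd : 0 < d) (hne : (constraintSet p q α θ ε₀ μ).Nonempty) :
    0 ≤ ∫ g, supportFn (constraintSet p q α θ ε₀ μ) (WithLp.toLp 2 g) / √d ∂(gaussianVec d) := by
  obtain ⟨z, hz⟩ := hne
  have hs : 0 < √(d : ℝ) := Real.sqrt_pos.2 (by positivity)
  have h1 : ∀ g : Fin d → ℝ, √d * avg (fun i => z i * g i) ≤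
      supportFn (constraintSet p q α θ ε₀ μ) (WithLp.toLp 2 g) / √d := fun g => by
    rw [le_div_iff₀ hs]
    refine le_trans (le_of_eq ?_) (inner_le_supportFn norm_le_of_mem_constraintSet hz _)
    have hd' : (d : ℝ) ≠ 0 := by positivity
    rw [inner_eq_sum, avg]
    have hss : √(d : ℝ) * √(d : ℝ) = d := Real.mul_self_sqrt (by positivity)
    calc √(d : ℝ) * ((d : ℝ)⁻¹ * ∑ i, z i * g i) * √d
        = (√(d : ℝ) * √d) * (d : ℝ)⁻¹ * ∑ i, z i * g i := by ring
      _ = _ := by rw [hss, mul_inv_cancel₀ hd', one_mul]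
  have h2 := integral_mono ((integrable_avg_mul_gaussianVec fun i => z i).const_mul (√d))
    ((integrable_supportFn hd norm_le_of_mem_constraintSet ⟨z, hz⟩).div_const _) h1
  rwa [integral_const_mul, integral_avg_mul_gaussianVec, mul_zero] at h2

variable (hd : 0 < d) (hpq : p.HolderConjugate q) (hα : 0 ≤ α) (hε₀ : 0 < ε₀) (hμ : 0 < ‖μ‖)
  (hμp : 0 < avg (fun i => |√d * μ i| ^ p))
include hd hpq hα hε₀ hμ hμp

/-- Weak duality at finite dimension, in the mean. -/
lemma integral_supportFn_le (hne : (constraintSet p q α θ ε₀ μ).Nonempty) {lam η : ℝ}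
    (hl : 0 ≤ lam) (hη : 0 < η) (c : ℝ) :
    ∫ g, supportFn (constraintSet p q α θ ε₀ μ) (WithLp.toLp 2 g) / √d ∂(gaussianVec d) ≤
      c * (θ * ‖μ‖) + η / 2 * (α ^ 2 + θ ^ 2) +
        lam * (ε₀ * (avg (fun i => |√d * μ i| ^ p)) ^ (1 / p)) ^ (-q) +
        avg (fun i => ∫ h, conj q η lam (h - c * (√d * μ i)) ∂(gaussianReal 0 1)) := by
  have hs : 0 < √(d : ℝ) := Real.sqrt_pos.2 (by positivity)
  have hq0 := hpq.symm.pos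
  set B := (ε₀ * (avg (fun i => |√d * μ i| ^ p)) ^ (1 / p)) ^ (-q)
  have hpt : ∀ g : Fin d → ℝ, supportFn (constraintSet p q α θ ε₀ μ) (WithLp.toLp 2 g) / √d ≤
      c * (θ * ‖μ‖) + η / 2 * (α ^ 2 + θ ^ 2) + lam * B +
        avg (fun i => conj q η lam (g i - c * (√d * μ i))) -
        θ / ‖μ‖ * avg (fun i => √d * μ i * g i) := by
    intro g
    rw [div_le_iff₀ hs]
    refine supportFn_le hne fun z hz => ?_
    set W : Fin d → ℝ := fun i => √d * (z i + θ * (μ i / ‖μ‖)) with hW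
    obtain ⟨h1, h2, h3⟩ := (mem_constraintSet_iff hd hpq hα hε₀ hμ hμp (W := W)
      fun i => rfl).1 hz
    rw [inner_toLp_eq hd (W := W) fun i => rfl, mul_comm]
    refine mul_le_mul_of_nonneg_right ?_ hs.le
    have h4 : avg (fun i => W i * g i) = avg (fun i => gain q η lam (g i - c * (√d * μ i)) (W i)) +
        c * avg (fun i => W i * (√d * μ i)) + η / 2 * avg (fun i => W i ^ 2) +
        lam * avg (fun i => |W i| ^ q) := by
      rw [← avg_const_mul, ← avg_const_mul, ← avg_const_mul, ← avg_add, ← avg_add, ← avg_add]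
      congr 1
      ext i
      unfold gain
      ring
    have h5 : avg (fun i => gain q η lam (g i - c * (√d * μ i)) (W i)) ≤
        avg (fun i => conj q η lam (g i - c * (√d * μ i))) :=
      avg_mono fun i => gain_le_conj hη hl _ _
    have h6 := mul_le_mul_of_nonneg_left h2 (by positivity : 0 ≤ η / 2)
    have h7 := mul_le_mul_of_nonneg_left h3 hl
    rw [h4, h1]
    linarith
  have hcc := continuous_conj (q := q) hη hl
  have hci : ∀ i, Integrable (fun h => conj q η lam (h - c * (√d * μ i))) (gaussianReal 0 1) :=
    fun i => (hasGrowth_conj hq0 hη hl c).integrable_left (by fun_prop) (√d * μ i)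
  have hci' : ∀ i, Integrable (fun g : Fin d → ℝ => conj q η lam (g i - c * (√d * μ i)))
      (gaussianVec d) := fun i =>
    integrable_comp_apply_gaussianVec i (f := fun h => conj q η lam (h - c * (√d * μ i))) (hci i)
  have i1 : Integrable (fun g : Fin d → ℝ =>
      avg (fun i => conj q η lam (g i - c * (√d * μ i)))) (gaussianVec d) := integrable_avg hci'
  have i2 : Integrable (fun g : Fin d → ℝ => c * (θ * ‖μ‖) + η / 2 * (α ^ 2 + θ ^ 2) + lam * B +
      avg (fun i => conj q η lam (g i - c * (√d * μ i)))) (gaussianVec d) :=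
    (integrable_const _).add i1
  have i3 := (integrable_avg_mul_gaussianVec fun i => √d * μ i).const_mul (θ / ‖μ‖)
  refine (integral_mono ((integrable_supportFn hd norm_le_of_mem_constraintSet hne).div_const _)
    (i2.sub i3) hpt).trans (le_of_eq ?_)
  simp only [Pi.sub_apply]
  rw [integral_sub i2 i3, integral_add (integrable_const _) i1, integral_avg hci',
    integral_const_mul, integral_avg_mul_gaussianVec]
  have h8 : ∀ i, ∫ g : Fin d → ℝ, conj q η lam (g i - c * (√d * μ i)) ∂(gaussianVec d) =
      ∫ h, conj q η lam (h - c * (√d * μ i)) ∂(gaussianReal 0 1) := fun i =>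
    integral_comp_apply_gaussianVec i (f := fun h => conj q η lam (h - c * (√d * μ i)))
      (by fun_prop)
  simp_rw [h8]
  simp

/-- A vector `W` satisfying the normalized constraints gives a lower bound for the support
function. -/
lemma avg_mul_le_supportFn_div_add (W g : Fin d → ℝ)
    (h1 : avg (fun i => W i * (√d * μ i)) = θ * ‖μ‖)
    (h2 : avg (fun i => W i ^ 2) ≤ α ^ 2 + θ ^ 2)
    (h3 : avg (fun i => |W i| ^ q) ≤
      (ε₀ * (avg (fun i => |√d * μ i| ^ p)) ^ (1 / p)) ^ (-q)) :
    avg (fun i => W i * g i) ≤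
      supportFn (constraintSet p q α θ ε₀ μ) (WithLp.toLp 2 g) / √d +
        θ / ‖μ‖ * avg (fun i => √d * μ i * g i) := by
  have hs : 0 < √(d : ℝ) := Real.sqrt_pos.2 (by positivity)
  let z : EuclideanSpace ℝ (Fin d) := WithLp.toLp 2 fun i => W i / √d - θ * (μ i / ‖μ‖)
  have hW : ∀ i, W i = √d * (z i + θ * (μ i / ‖μ‖)) := fun i => by
    simp only [z]
    field_simp
    ring
  have hz : z ∈ constraintSet p q α θ ε₀ μ :=
    (mem_constraintSet_iff hd hpq hα hε₀ hμ hμp hW).2 ⟨h1, h2, h3⟩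
  have h4 := inner_le_supportFn norm_le_of_mem_constraintSet hz (WithLp.toLp 2 g)
  rw [inner_toLp_eq hd hW, mul_comm, ← le_div_iff₀ hs] at h4
  linarith

/-- A pointwise lower bound for the support function by means of the competitors
`W i = F (g i, v i) + c χ (v i)`, where `c` is chosen to meet the linear constraint. If the first
three averages deviate from their targets by more than `ε`, then `W` may be infeasible, but the
last term on the left makes up for the trivial lower bound. -/
lemma le_supportFn_div_add (hne : (constraintSet p q α θ ε₀ μ).Nonempty)
    (F : BoundedContinuousFunction (ℝ × ℝ) ℝ) (χ : BoundedContinuousFunction ℝ ℝ)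
    {e₁ e₂ e₃ e₄ ε b : ℝ} (he₂ : e₂ ≤ α ^ 2 + θ ^ 2) (he₃ : e₃ ≤ b)
    (hε : 0 < ε) (hε4 : ε ≤ 1 / 4)
    (h₂ : e₂ + ε * (1 + 4 * (2 ^ (2 : ℝ) * (α ^ 2 + θ ^ 2 + 1 + ‖χ‖ ^ (2 : ℝ)))) ≤ α ^ 2 + θ ^ 2)
    (h₃ : e₃ + ε * (1 + 4 * (2 ^ q * (b + 1 + ‖χ‖ ^ q))) ≤
      (ε₀ * (avg (fun i => |√d * μ i| ^ p)) ^ (1 / p)) ^ (-q))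
    (hθ : |θ * ‖μ‖ - e₁| ≤ ε) (hχ : 1 / 2 ≤ avg (fun i => χ (√d * μ i) * (√d * μ i)))
    (g : Fin d → ℝ) :
    e₄ - |avg (fun i => F (g i, √d * μ i) * g i) - e₄| - |avg (fun i => χ (√d * μ i) * g i) - 0| -
      (α + |θ|) * |avg (fun i => g i ^ 2) - 1| -
      (|e₄| + α + |θ|) / ε * (|avg (fun i => F (g i, √d * μ i) * (√d * μ i)) - e₁| +
        |avg (fun i => F (g i, √d * μ i) ^ 2) - e₂| +
        |avg (fun i => |F (g i, √d * μ i)| ^ q) - e₃|) ≤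
      supportFn (constraintSet p q α θ ε₀ μ) (WithLp.toLp 2 g) / √d +
        θ / ‖μ‖ * avg (fun i => √d * μ i * g i) := by
  have hs : 0 < √(d : ℝ) := Real.sqrt_pos.2 (by positivity)
  have hq1 : 1 < q := hpq.symm.lt
  set X₁ := avg (fun i => F (g i, √d * μ i) * (√d * μ i)) with hX₁
  set X₂ := avg (fun i => F (g i, √d * μ i) ^ 2) with hX₂
  set X₃ := avg (fun i => |F (g i, √d * μ i)| ^ q) with hX₃
  set X₄ := avg (fun i => F (g i, √d * μ i) * g i) with hX₄
  set X₅ := avg (fun i => χ (√d * μ i) * g i) with hX₅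
  set X₆ := avg (fun i => g i ^ 2) with hX₆
  have hX₆0 : 0 ≤ X₆ := avg_nonneg fun i => sq_nonneg _
  have hX₂0 : 0 ≤ X₂ := avg_nonneg fun i => sq_nonneg _
  have hX₃0 : 0 ≤ X₃ := avg_nonneg fun i => Real.rpow_nonneg (abs_nonneg _) _
  have hα6 : 0 ≤ (α + |θ|) * |X₆ - 1| := by positivity
  by_cases hgood : |X₁ - e₁| + |X₂ - e₂| + |X₃ - e₃| ≤ ε
  · have a1 : |X₁ - e₁| ≤ ε := by linarith [abs_nonneg (X₂ - e₂), abs_nonneg (X₃ - e₃)]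
    have a2 : X₂ - e₂ ≤ ε := by
      linarith [abs_nonneg (X₁ - e₁), abs_nonneg (X₃ - e₃), le_abs_self (X₂ - e₂)]
    have a3 : X₃ - e₃ ≤ ε := by
      linarith [abs_nonneg (X₁ - e₁), abs_nonneg (X₂ - e₂), le_abs_self (X₃ - e₃)]
    set y := avg (fun i => χ (√d * μ i) * (√d * μ i)) with hy
    have hy0 : 0 < y := by linarith
    set c := (θ * ‖μ‖ - X₁) / y with hc
    have hcε : |c| ≤ 4 * ε := by
      rw [hc, abs_div, abs_of_pos hy0, div_le_iff₀ hy0]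
      have : |θ * ‖μ‖ - X₁| ≤ 2 * ε := by
        have h := abs_sub_le (θ * ‖μ‖) e₁ X₁
        rw [abs_sub_comm e₁ X₁] at h
        linarith
      nlinarith
    have hc1 : |c| ≤ 1 := by linarith
    set W : Fin d → ℝ := fun i => F (g i, √d * μ i) + c * χ (√d * μ i) with hW
    have hWr : ∀ r : ℝ, 1 ≤ r → avg (fun i => |W i| ^ r) ≤
        avg (fun i => |F (g i, √d * μ i)| ^ r) +
          |c| * (2 ^ r * (avg (fun i => |F (g i, √d * μ i)| ^ r) + ‖χ‖ ^ r)) := by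
      intro r hr
      have h1 : ∀ i, |W i| ^ r ≤ |F (g i, √d * μ i)| ^ r +
          |c| * (2 ^ r * (|F (g i, √d * μ i)| ^ r + ‖χ‖ ^ r)) := fun i => by
        refine (abs_add_mul_rpow_le hr _ _ hc1).trans ?_
        have : |χ (√d * μ i)| ^ r ≤ ‖χ‖ ^ r :=
          Real.rpow_le_rpow (abs_nonneg _) (χ.norm_coe_le_norm _) (by linarith)
        gcongr
      refine (avg_mono h1).trans (le_of_eq ?_)
      rw [avg_add, avg_const_mul, avg_const_mul, avg_add, avg_const hd]
    have w1 : avg (fun i => W i * (√d * μ i)) = θ * ‖μ‖ := by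
      have : avg (fun i => W i * (√d * μ i)) = X₁ + c * y := by
        rw [hX₁, hy, ← avg_const_mul, ← avg_add]
        congr 1
        ext i
        simp only [hW]
        ring
      rw [this, hc]
      field_simp
      ring
    have w2 : avg (fun i => W i ^ 2) ≤ α ^ 2 + θ ^ 2 := by
      have h := hWr 2 one_le_two
      have hsq : ∀ x : ℝ, |x| ^ (2 : ℝ) = x ^ 2 := fun x => by simp
      simp_rw [hsq] at h
      rw [← hX₂] at h
      have h' : |c| * (2 ^ (2 : ℝ) * (X₂ + ‖χ‖ ^ (2 : ℝ))) ≤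
          4 * ε * (2 ^ (2 : ℝ) * (α ^ 2 + θ ^ 2 + 1 + ‖χ‖ ^ (2 : ℝ))) := by
        gcongr
        linarith
      linarith
    have w3 : avg (fun i => |W i| ^ q) ≤
        (ε₀ * (avg (fun i => |√d * μ i| ^ p)) ^ (1 / p)) ^ (-q) := by
      have h := hWr q hq1.le
      rw [← hX₃] at h
      have h' : |c| * (2 ^ q * (X₃ + ‖χ‖ ^ q)) ≤ 4 * ε * (2 ^ q * (b + 1 + ‖χ‖ ^ q)) := by
        gcongr
        linarith
      linarith
    have h5 := avg_mul_le_supportFn_div_add hd hpq hα hε₀ hμ hμp W g w1 w2 w3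
    have h6 : avg (fun i => W i * g i) = X₄ + c * X₅ := by
      rw [hX₄, hX₅, ← avg_const_mul, ← avg_add]
      congr 1
      ext i
      simp only [hW]
      ring
    rw [h6] at h5
    have h7 : -|X₅| ≤ c * X₅ := by
      have : |c * X₅| ≤ |X₅| := by
        rw [abs_mul]
        exact mul_le_of_le_one_left (abs_nonneg _) hc1
      linarith [neg_abs_le (c * X₅)]
    have h8 : 0 ≤ (|e₄| + α + |θ|) / ε * (|X₁ - e₁| + |X₂ - e₂| + |X₃ - e₃|) := by positivity
    rw [sub_zero]
    linarith [neg_abs_le (X₄ - e₄)]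
  · rw [not_le] at hgood
    have h1 : |e₄| + α + |θ| ≤ (|e₄| + α + |θ|) / ε * (|X₁ - e₁| + |X₂ - e₂| + |X₃ - e₃|) := by
      rw [div_mul_eq_mul_div, le_div_iff₀ hε]
      exact mul_le_mul_of_nonneg_left hgood.le (by positivity)
    have hsq6 : √X₆ ≤ 1 + |X₆ - 1| := by
      have := abs_sqrt_sub_one_le hX₆0
      linarith [le_abs_self (√X₆ - 1)]
    have h2 : -(α * √X₆) ≤ supportFn (constraintSet p q α θ ε₀ μ) (WithLp.toLp 2 g) / √d := by
      have h := abs_supportFn_le (x := (WithLp.toLp 2 g : EuclideanSpace ℝ (Fin d)))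
        (norm_le_of_mem_constraintSet (p := p) (q := q) (α := α) (θ := θ) (ε₀ := ε₀) (μ := μ)) hne
      rw [norm_toLp_eq hd, ← hX₆] at h
      rw [le_div_iff₀ hs]
      linarith [(abs_le.1 h).1]
    have h3 : -(|θ| * √X₆) ≤ θ / ‖μ‖ * avg (fun i => √d * μ i * g i) := by
      have h := abs_real_inner_le_norm μ (WithLp.toLp 2 g)
      rw [norm_toLp_eq hd g, ← hX₆] at h
      have h' : avg (fun i => √d * μ i * g i) = inner ℝ μ (WithLp.toLp 2 g) / √d := by
        have hd' : (d : ℝ) ≠ 0 := by positivity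
        have hss : √(d : ℝ) * √(d : ℝ) = d := Real.mul_self_sqrt (by positivity)
        simp_rw [mul_assoc]
        rw [avg_const_mul, avg, inner_eq_sum, eq_div_iff hs.ne']
        calc √(d : ℝ) * ((d : ℝ)⁻¹ * ∑ i, μ i * g i) * √d
            = (√(d : ℝ) * √d) * (d : ℝ)⁻¹ * ∑ i, μ i * g i := by ring
          _ = _ := by rw [hss, mul_inv_cancel₀ hd', one_mul]
      have h4 : |θ / ‖μ‖ * avg (fun i => √d * μ i * g i)| ≤ |θ| * √X₆ := by
        rw [h', abs_mul, abs_div, abs_div, abs_of_pos hμ, abs_of_pos hs]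
        calc |θ| / ‖μ‖ * (|inner ℝ μ (WithLp.toLp 2 g)| / √d)
            ≤ |θ| / ‖μ‖ * (‖μ‖ * (√d * √X₆) / √d) := by gcongr
          _ = |θ| * √X₆ := by field_simp
      linarith [neg_abs_le (θ / ‖μ‖ * avg (fun i => √d * μ i * g i))]
    have h5 : (α + |θ|) * √X₆ ≤ (α + |θ|) * (1 + |X₆ - 1|) :=
      mul_le_mul_of_nonneg_left hsq6 (by positivity)
    linarith [le_abs_self e₄, abs_nonneg (X₄ - e₄), abs_nonneg (X₅ - 0)]

end FixedDimension

lemma integrable_abs_avg_sub {d : ℕ} {f : ℝ × ℝ → ℝ} (hf : Continuous f) (hg : HasGrowth f)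
    (v : Fin d → ℝ) (e : ℝ) :
    Integrable (fun g : Fin d → ℝ => |avg (fun i => f (g i, v i)) - e|) (gaussianVec d) := by
  have h : Integrable (fun g : Fin d → ℝ => avg (fun i => f (g i, v i))) (gaussianVec d) :=
    integrable_avg fun i => integrable_comp_apply_gaussianVec i (f := fun h => f (h, v i))
      (hg.integrable_left hf _)
  exact (h.sub (integrable_const e)).abs

lemma hasGrowth_bcf_mul_sq (F : BoundedContinuousFunction (ℝ × ℝ) ℝ) {g : ℝ × ℝ → ℝ}
    (hg : HasGrowth (fun x => g x ^ 2)) : HasGrowth (fun x => (F x * g x) ^ 2) := by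
  simp_rw [mul_pow]
  refine hg.bounded_mul (‖F‖ ^ 2) fun x => ?_
  rw [abs_pow]
  exact pow_le_pow_left₀ (abs_nonneg _) (abs_bcf_le F x) 2

/-! ### Passage to the limit -/

section Limit

variable {d : ℕ → ℕ} {p q α θ ε₀ σ B : ℝ} {μ : ∀ n, EuclideanSpace ℝ (Fin (d n))}
  {P : ProbabilityMeasure ℝ}
  (hd : Tendsto (fun n => (d n : ℝ)) atTop atTop) (hpq : p.HolderConjugate q)
  (hα : 0 ≤ α) (hε₀ : 0 < ε₀)
  (hweak : Tendsto (fun n => empirical (fun i => √(d n : ℝ) * μ n i)) atTop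
    (𝓝 P.toFiniteMeasure))
  (hP2 : Integrable (fun x : ℝ => x ^ 2) (P : Measure ℝ))
  (hmom : Tendsto (fun n => avg (fun i => (√(d n : ℝ) * μ n i) ^ 2)) atTop
    (𝓝 (∫ x, x ^ 2 ∂(P : Measure ℝ))))
  (hσ : Tendsto (fun n => ‖μ n‖) atTop (𝓝 σ)) (hσ0 : 0 < σ)
  (hB : Tendsto (fun n => (ε₀ * (avg (fun i => |√(d n : ℝ) * μ n i| ^ p)) ^ (1 / p)) ^ (-q))
    atTop (𝓝 B))
  (hμp : ∀ᶠ n in atTop, 0 < avg (fun i => |√(d n : ℝ) * μ n i| ^ p))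
  (hne : ∀ᶠ n in atTop, (constraintSet p q α θ ε₀ (μ n)).Nonempty)
include hd hpq hα hε₀ hweak hP2 hmom hσ hσ0 hB hμp hne

/-- Every dual value is an asymptotic upper bound. -/
lemma eventually_integral_supportFn_lt {lam η ν : ℝ} (hl : 0 ≤ lam) (hη : 0 < η) {b : ℝ}
    (hb : dualValue q (α ^ 2 + θ ^ 2) B θ σ (P : Measure ℝ) lam η ν < b) :
    ∀ᶠ n in atTop, ∫ g, supportFn (constraintSet p q α θ ε₀ (μ n)) (WithLp.toLp 2 g) / √(d n)
      ∂(gaussianVec (d n)) < b := by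
  set c := ν / σ with hc
  have hcc := continuous_conj (q := q) hη hl
  have h1 := tendsto_avg_mean hweak hP2 hmom
    (f := fun x => conj q η lam (x.1 - c * x.2)) (by fun_prop)
    (hasGrowth_conj hpq.symm.pos hη hl c)
  have h2 := ((((hσ.const_mul θ).const_mul c).add_const (η / 2 * (α ^ 2 + θ ^ 2))).add
    (hB.const_mul lam)).add h1
  have h3 : c * (θ * σ) + η / 2 * (α ^ 2 + θ ^ 2) + lam * B +
      ∫ x : ℝ × ℝ, conj q η lam (x.1 - c * x.2) ∂((gaussianReal 0 1).prod (P : Measure ℝ)) =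
      dualValue q (α ^ 2 + θ ^ 2) B θ σ (P : Measure ℝ) lam η ν := by
    rw [dualValue, ← hc]
    have : c * (θ * σ) = ν * θ := by rw [hc]; field_simp
    rw [this]
  rw [h3] at h2
  filter_upwards [(tendsto_order.1 h2).2 _ hb, hd.eventually_gt_atTop 0, hμp, hne,
    (tendsto_order.1 hσ).1 0 hσ0] with n hn hdn hpn hnn hμn
  exact (integral_supportFn_le (by exact_mod_cast hdn) hpq hα hε₀ hμn hpn hnn hl hη c).trans_lt hn

/-- A strictly feasible function of `(h, M)` gives an asymptotic lower bound. -/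
lemma eventually_lt_integral_supportFn (hP0 : 0 < ∫ x, x ^ 2 ∂(P : Measure ℝ))
    (F : BoundedContinuousFunction (ℝ × ℝ) ℝ)
    (hF1 : ∫ x, F x * x.2 ∂((gaussianReal 0 1).prod (P : Measure ℝ)) = θ * σ)
    (hF2 : ∫ x, F x ^ 2 ∂((gaussianReal 0 1).prod (P : Measure ℝ)) < α ^ 2 + θ ^ 2)
    (hF3 : ∫ x, |F x| ^ q ∂((gaussianReal 0 1).prod (P : Measure ℝ)) < B) {a : ℝ}
    (ha : a < ∫ x, F x * x.1 ∂((gaussianReal 0 1).prod (P : Measure ℝ))) :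
    ∀ᶠ n in atTop, a < ∫ g, supportFn (constraintSet p q α θ ε₀ (μ n)) (WithLp.toLp 2 g) / √(d n)
      ∂(gaussianVec (d n)) := by
  have hq0 : 0 ≤ q := hpq.symm.pos.le
  obtain ⟨χ, hχ⟩ := exists_correlated hP2 hP0
  let χ' : BoundedContinuousFunction (ℝ × ℝ) ℝ := χ.compContinuous ⟨Prod.snd, continuous_snd⟩
  set e₂ := ∫ x, F x ^ 2 ∂((gaussianReal 0 1).prod (P : Measure ℝ)) with he₂
  set e₃ := ∫ x, |F x| ^ q ∂((gaussianReal 0 1).prod (P : Measure ℝ)) with he₃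
  set e₄ := ∫ x, F x * x.1 ∂((gaussianReal 0 1).prod (P : Measure ℝ)) with he₄
  have he₃0 : 0 ≤ e₃ := integral_nonneg fun x => Real.rpow_nonneg (abs_nonneg _) _
  have hB0 : 0 < B := he₃0.trans_lt hF3
  have he₅ : ∫ x, χ' x * x.1 ∂((gaussianReal 0 1).prod (P : Measure ℝ)) = 0 := by
    refine Eq.trans ?_ (integral_fst_mul_comp_snd (P := P) χ)
    exact integral_congr_ae (ae_of_all _ fun x : ℝ × ℝ => mul_comm (χ x.2) x.1)
  have he₆ : ∫ x : ℝ × ℝ, x.1 ^ 2 ∂((gaussianReal 0 1).prod (P : Measure ℝ)) = 1 := by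
    rw [integral_fun_fst (fun h : ℝ => h ^ 2), integral_fst_sq_gaussian]; simp
  set L₂ := 1 + 4 * (2 ^ (2 : ℝ) * (α ^ 2 + θ ^ 2 + 1 + ‖χ‖ ^ (2 : ℝ))) with hL₂
  set L₃ := 1 + 4 * (2 ^ q * (B + 1 + ‖χ‖ ^ q)) with hL₃
  have hL₂0 : 0 < L₂ := by positivity
  have hL₃0 : 0 < L₃ := by positivity
  -- the admissible deviation of the averages, such that both inequality constraints keep holding;
  -- half of the slack `B - e₃` is left for the convergence of the finite-dimensional bound
  obtain ⟨ε, hε0, hε4, hε2, hε3⟩ : ∃ ε, 0 < ε ∧ ε ≤ 1 / 4 ∧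
      ε ≤ (α ^ 2 + θ ^ 2 - e₂) / L₂ ∧ ε ≤ (B - e₃) / (2 * L₃) := by
    refine ⟨min (1 / 4) (min ((α ^ 2 + θ ^ 2 - e₂) / L₂) ((B - e₃) / (2 * L₃))), ?_,
      min_le_left _ _, (min_le_right _ _).trans (min_le_left _ _),
      (min_le_right _ _).trans (min_le_right _ _)⟩
    refine lt_min (by norm_num) (lt_min (div_pos (by linarith) hL₂0)
      (div_pos (by linarith) (by positivity)))
  rw [le_div_iff₀ hL₂0] at hε2
  rw [le_div_iff₀ (by positivity)] at hε3
  -- the six laws of large numbers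
  have g1 := hasGrowth_bcf_mul F hasGrowth_snd
  have g1' := hasGrowth_bcf_mul_sq F hasGrowth_snd_sq
  have gF : HasGrowth (fun x => F x ^ 2) := by
    simpa using hasGrowth_abs_bcf_rpow F (r := 2) (by norm_num)
  have gF' : HasGrowth (fun x => (F x ^ 2) ^ 2) := by
    have := hasGrowth_abs_bcf_rpow (F ^ 2) (r := 2) (by norm_num)
    simpa using this
  have g3 := hasGrowth_abs_bcf_rpow F hq0
  have g3' : HasGrowth (fun x => (|F x| ^ q) ^ 2) := by
    refine hasGrowth_of_bounded ((‖F‖ ^ q) ^ 2) fun x => ?_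
    have h0 : 0 ≤ |F x| ^ q := Real.rpow_nonneg (abs_nonneg _) _
    rw [abs_of_nonneg (by positivity)]
    exact pow_le_pow_left₀ h0 (abs_bcf_rpow_le F hq0 x) 2
  have g4 := hasGrowth_bcf_mul F hasGrowth_fst
  have g4' := hasGrowth_bcf_mul_sq F hasGrowth_fst_sq
  have g5 := hasGrowth_bcf_mul χ' hasGrowth_fst
  have g5' := hasGrowth_bcf_mul_sq χ' hasGrowth_fst_sq
  have g6' : HasGrowth (fun x : ℝ × ℝ => (x.1 ^ 2) ^ 2) := by
    simpa only [← pow_mul] using hasGrowth_fst_pow_four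
  have c3 := continuous_abs_bcf_rpow F hq0
  have c1 : Continuous fun x : ℝ × ℝ => F x * x.2 := by fun_prop
  have c2 : Continuous fun x : ℝ × ℝ => F x ^ 2 := by fun_prop
  have c4 : Continuous fun x : ℝ × ℝ => F x * x.1 := by fun_prop
  have c5 : Continuous fun x : ℝ × ℝ => χ' x * x.1 := by fun_prop
  have c6 : Continuous fun x : ℝ × ℝ => x.1 ^ 2 := by fun_prop
  have t1 := tendsto_integral_abs_avg_sub hd hweak hP2 hmom c1 g1 g1'
  have t2 := tendsto_integral_abs_avg_sub hd hweak hP2 hmom c2 gF gF'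
  have t3 := tendsto_integral_abs_avg_sub hd hweak hP2 hmom c3 g3 g3'
  have t4 := tendsto_integral_abs_avg_sub hd hweak hP2 hmom c4 g4 g4'
  have t5 := tendsto_integral_abs_avg_sub hd hweak hP2 hmom c5 g5 g5'
  have t6 := tendsto_integral_abs_avg_sub hd hweak hP2 hmom c6 hasGrowth_fst_sq g6'
  rw [hF1] at t1
  rw [← he₂] at t2
  rw [← he₃] at t3
  rw [← he₄] at t4
  rw [he₅] at t5
  rw [he₆] at t6
  set K := (|e₄| + α + |θ|) / ε with hK
  have hlim := (((t4.const_sub e₄).sub t5).sub (t6.const_mul (α + |θ|))).sub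
    (((t1.add t2).add t3).const_mul K)
  simp only [sub_zero, mul_zero, add_zero] at hlim
  have hχlim : Tendsto (fun n => avg (fun i => χ (√(d n : ℝ) * μ n i) * (√(d n : ℝ) * μ n i)))
      atTop (𝓝 1) := by
    rw [← hχ]
    refine tendsto_avg_of_quadratic hweak hP2 hmom (f := fun m => χ m * m) (by fun_prop)
      (C := ‖χ‖) fun m => ?_
    rw [abs_mul]
    refine mul_le_mul (χ.norm_coe_le_norm m) ?_ (abs_nonneg _) (norm_nonneg _)
    nlinarith [sq_nonneg (|m| - 1), sq_abs m, abs_nonneg m]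
  have hθlim : Tendsto (fun n => |θ * ‖μ n‖ - θ * σ|) atTop (𝓝 0) := by
    simpa using ((hσ.const_mul θ).sub_const (θ * σ)).abs
  filter_upwards [(tendsto_order.1 hlim).1 a ha, hd.eventually_gt_atTop 0, hμp, hne,
    (tendsto_order.1 hσ).1 0 hσ0, (tendsto_order.1 hχlim).1 (1 / 2) (by norm_num),
    (tendsto_order.1 hθlim).2 ε hε0, (tendsto_order.1 hB).1 ((e₃ + B) / 2) (by linarith)]
    with n hn hdn hpn hnn hμn hχn hθn hBn
  have hdn' : 0 < d n := by exact_mod_cast hdn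
  refine hn.trans_le ?_
  set v : Fin (d n) → ℝ := fun i => √(d n : ℝ) * μ n i with hv
  have hpt := le_supportFn_div_add hdn' hpq hα hε₀ hμn hpn hnn F χ (e₁ := θ * σ) (e₂ := e₂)
    (e₃ := e₃) (e₄ := e₄) (ε := ε) (b := B) hF2.le hF3.le hε0 hε4 (by linarith) (by linarith)
    hθn.le hχn.le
  have j1 := integrable_abs_avg_sub c1 g1 v (θ * σ)
  have j2 := integrable_abs_avg_sub c2 gF v e₂
  have j3 := integrable_abs_avg_sub c3 g3 v e₃
  have j4 := integrable_abs_avg_sub c4 g4 v e₄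
  have j5 := integrable_abs_avg_sub c5 g5 v 0
  have j6 := integrable_abs_avg_sub c6 hasGrowth_fst_sq v 1
  have js := (integrable_supportFn hdn' (norm_le_of_mem_constraintSet (p := p) (q := q) (α := α)
    (θ := θ) (ε₀ := ε₀) (μ := μ n)) hnn).div_const (√(d n : ℝ))
  have jv := (integrable_avg_mul_gaussianVec v).const_mul (θ / ‖μ n‖)
  have k4 := (integrable_const (μ := gaussianVec (d n)) e₄).sub j4
  have k12 := j1.add j2
  have k123 := k12.add j3
  have k45 := k4.sub j5
  have k456 := k45.sub (j6.const_mul (α + |θ|))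
  have hmono := integral_mono (k456.sub (k123.const_mul K)) (js.add jv) hpt
  rw [integral_sub' k456 (k123.const_mul K), integral_sub' k45 (j6.const_mul (α + |θ|)),
    integral_sub' k4 j5, integral_sub' (integrable_const _) j4, integral_add' js jv,
    integral_const_mul, integral_const_mul, integral_const_mul, integral_add' k12 j3,
    integral_add' j1 j2, integral_avg_mul_gaussianVec] at hmono
  simp only [integral_const, probReal_univ, smul_eq_mul, one_mul, mul_zero, add_zero,
    sub_zero] at hmono
  exact hmono

end Limit

lemma integral_abs_rpow_pos {r : ℝ} (hr : 0 < r) {P : Measure ℝ}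
    (hi : Integrable (fun x : ℝ => |x| ^ r) P) (hP0 : 0 < ∫ x, x ^ 2 ∂P) :
    0 < ∫ x, |x| ^ r ∂P := by
  have hnn : ∀ x : ℝ, 0 ≤ |x| ^ r := fun x => Real.rpow_nonneg (abs_nonneg _) _
  refine lt_of_le_of_ne (integral_nonneg hnn) fun h => hP0.ne' ?_
  rw [eq_comm, integral_eq_zero_iff_of_nonneg hnn hi] at h
  refine integral_eq_zero_of_ae ?_
  filter_upwards [h] with x hx
  have : |x| = 0 := (Real.rpow_eq_zero (abs_nonneg x) hr.ne').1 hx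
  simp [abs_eq_zero.1 this]

/-- The junk value `n / 0 = 0` is excluded by the positivity of the limit. -/
lemma tendsto_dim_atTop {δ : ℝ} (hδ : 0 < δ) {d : ℕ → ℕ}
    (hd : Tendsto (fun n : ℕ => (n : ℝ) / (d n : ℝ)) atTop (𝓝 δ)) :
    Tendsto (fun n => (d n : ℝ)) atTop atTop := by
  have h1 : Tendsto (fun n : ℕ => (n : ℝ) / (δ + 1)) atTop atTop :=
    tendsto_natCast_atTop_atTop.atTop_div_const (by linarith)
  refine tendsto_atTop_mono' _ ?_ h1
  filter_upwards [(tendsto_order.1 hd).1 0 hδ, (tendsto_order.1 hd).2 (δ + 1) (by linarith)]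
    with n h2 h3
  have hdn : (0 : ℝ) < d n := by
    rcases (Nat.cast_nonneg (d n) : (0 : ℝ) ≤ d n).eq_or_lt with h | h
    · rw [← h, div_zero] at h2
      exact absurd h2 (lt_irrefl _)
    · exact h
  rw [div_lt_iff₀ hdn] at h3
  rw [div_le_iff₀ (by linarith)]
  linarith

/-- The values of the objective are the values of the dual function. -/
lemma setOf_objective_eq {p q δ α θ ε₀ : ℝ} {P : ProbabilityMeasure ℝ}
    (hq : 0 < q) (hδ : 0 < δ) (hP2 : Integrable (fun x : ℝ => x ^ 2) (P : Measure ℝ))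
    (hP0 : 0 < sigma 2 (P : Measure ℝ)) :
    {y : ℝ | ∃ lam η ν : ℝ, 0 ≤ lam ∧ 0 < η ∧
      y = objective p q δ α θ ε₀ (P : Measure ℝ) lam η ν} =
    {y : ℝ | ∃ lam η ν : ℝ, 0 ≤ lam ∧ 0 < η ∧
      y = dualValue q (α ^ 2 + θ ^ 2) ((ε₀ * sigma p (P : Measure ℝ)) ^ (-q)) θ
        (sigma 2 (P : Measure ℝ)) (P : Measure ℝ) lam η ν} := by
  have hs : 0 < √δ := Real.sqrt_pos.2 hδ
  ext y
  constructor
  · rintro ⟨lam, η, ν, hl, hη, rfl⟩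
    exact ⟨√δ * lam, √δ * η, √δ * (ν - η * θ), by positivity, by positivity,
      objective_eq_dualValue hq hδ hη hl hP2 hP0⟩
  · rintro ⟨lam, η, ν, hl, hη, rfl⟩
    refine ⟨lam / √δ, η / √δ, ν / √δ + η / √δ * θ, by positivity, by positivity, ?_⟩
    rw [objective_eq_dualValue hq hδ (by positivity) (by positivity) hP2 hP0]
    congr 1 <;> field_simp
    ring

end RobustWidth

theorem mainTheorem9
    (p q : ℝ) (hpq : p.HolderConjugate q)
    (δ : ℝ) (hδ : 0 < δ)
    (ε₀ : ℝ) (hε₀ : 0 < ε₀)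
    -- dimensions `d n` and mean vectors `μ n`, with `n / d n → δ`
    (d : ℕ → ℕ) (hd : Tendsto (fun n : ℕ => (n : ℝ) / (d n : ℝ)) atTop (𝓝 δ))
    (μ : ∀ n, EuclideanSpace ℝ (Fin (d n)))
    -- the limiting distribution, not the point mass at zero, with finite moments
    (P : ProbabilityMeasure ℝ)
    (hP2 : Integrable (fun x : ℝ => |x| ^ (2 : ℝ)) (P : Measure ℝ))
    (hPp : Integrable (fun x : ℝ => |x| ^ p) (P : Measure ℝ))
    (hP0 : 0 < RobustWidth.sigma 2 (P : Measure ℝ))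
    -- the empirical distribution of the entries of `√d μ` converges weakly to `P`,
    -- together with its second and its `p`-th absolute moment
    (hweak : Tendsto (fun n => RobustWidth.empirical (fun i => √(d n : ℝ) * μ n i)) atTop
      (𝓝 P.toFiniteMeasure))
    (hmom2 : Tendsto
      (fun n => ∫ x, |x| ^ (2 : ℝ)
        ∂(RobustWidth.empirical (fun i => √(d n : ℝ) * μ n i) : Measure ℝ)) atTop
      (𝓝 (∫ x, |x| ^ (2 : ℝ) ∂(P : Measure ℝ))))
    (hmomp : Tendsto
      (fun n => ∫ x, |x| ^ p
        ∂(RobustWidth.empirical (fun i => √(d n : ℝ) * μ n i) : Measure ℝ)) atTop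
      (𝓝 (∫ x, |x| ^ p ∂(P : Measure ℝ))))
    (α θ : ℝ) (hα : 0 ≤ α)
    (hne : ∀ᶠ n in atTop, (RobustWidth.constraintSet p q α θ ε₀ (μ n)).Nonempty) :
    (∀ lam η ν : ℝ, 0 ≤ lam → 0 < η →
      Integrable (RobustWidth.envelope q δ θ (P : Measure ℝ) lam η ν)
        ((gaussianReal 0 1).prod (P : Measure ℝ))) ∧
    ∃ ω : ℝ,
      Tendsto
        (fun n => RobustWidth.sphericalWidth (RobustWidth.constraintSet p q α θ ε₀ (μ n)))
        atTop (𝓝 ω) ∧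
      IsGLB
        {y : ℝ | ∃ lam η ν : ℝ, 0 ≤ lam ∧ 0 < η ∧
          y = RobustWidth.objective p q δ α θ ε₀ (P : Measure ℝ) lam η ν} ω := by
  open RobustWidth in
  have hsq : ∀ x : ℝ, |x| ^ (2 : ℝ) = x ^ 2 := fun x => by simp
  simp_rw [hsq] at hP2 hmom2
  simp_rw [integral_empirical] at hmom2 hmomp
  have hp0 := hpq.pos
  have hq0 := hpq.symm.pos
  set σ := sigma 2 (P : Measure ℝ) with hσdef
  have hσ2 : σ ^ 2 = ∫ x, x ^ 2 ∂(P : Measure ℝ) := sigma_two_sq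
  have hP2pos : 0 < ∫ x, x ^ 2 ∂(P : Measure ℝ) := by rw [← hσ2]; positivity
  have hd' := tendsto_dim_atTop hδ hd
  have hdpos : ∀ᶠ n in atTop, 0 < d n :=
    (hd'.eventually_gt_atTop 0).mono fun n hn => by exact_mod_cast hn
  have hσ : Tendsto (fun n => ‖μ n‖) atTop (𝓝 σ) := by
    have h := hmom2.sqrt
    rw [← hσ2, Real.sqrt_sq hP0.le] at h
    refine h.congr' ?_
    filter_upwards [hdpos] with n hn
    rw [norm_eq_sqrt_avg hn]
  have hmp := integral_abs_rpow_pos hp0 hPp hP2pos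
  have hμp : ∀ᶠ n in atTop, 0 < avg (fun i => |√(d n : ℝ) * μ n i| ^ p) :=
    (tendsto_order.1 hmomp).1 0 hmp
  set B := (ε₀ * sigma p (P : Measure ℝ)) ^ (-q) with hBdef
  have hσp : 0 < sigma p (P : Measure ℝ) := Real.rpow_pos_of_pos hmp _
  have hB : Tendsto (fun n => (ε₀ * (avg (fun i => |√(d n : ℝ) * μ n i| ^ p)) ^ (1 / p)) ^ (-q))
      atTop (𝓝 B) := by
    refine Tendsto.rpow_const ((hmomp.rpow_const (Or.inl hmp.ne')).const_mul ε₀) (Or.inl ?_)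
    exact (mul_pos hε₀ hσp).ne'
  refine ⟨fun lam η ν hl hη => integrable_envelope hq0 hδ hη hl hP2, ?_⟩
  rw [setOf_objective_eq hq0 hδ hP2 hP0]
  set Y := {y : ℝ | ∃ lam η ν : ℝ, 0 ≤ lam ∧ 0 < η ∧
      y = dualValue q (α ^ 2 + θ ^ 2) B θ σ (P : Measure ℝ) lam η ν} with hY
  set U : ℕ → ℝ := fun n => ∫ g, supportFn (constraintSet p q α θ ε₀ (μ n)) (WithLp.toLp 2 g) /
    √(d n) ∂(gaussianVec (d n)) with hU
  have hU0 : ∀ᶠ n in atTop, 0 ≤ U n := by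
    filter_upwards [hdpos, hne] with n h1 h2
    exact integral_supportFn_nonneg h1 h2
  have hup : ∀ y ∈ Y, ∀ b, y < b → ∀ᶠ n in atTop, U n < b := by
    rintro y ⟨lam, η, ν, hl, hη, rfl⟩ b hb
    exact eventually_integral_supportFn_lt hd' hpq hα hε₀ hweak hP2 hmom2 hσ hP0 hB hμp hne
      hl hη hb
  have hYne : Y.Nonempty := ⟨_, 0, 1, 0, le_rfl, one_pos, rfl⟩
  have hYbdd : BddBelow Y := by
    refine ⟨0, fun y hy => le_of_forall_pos_lt_add fun ε hε => ?_⟩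
    obtain ⟨n, h1, h2⟩ := (hU0.and (hup y hy (y + ε) (by linarith))).exists
    linarith
  have hglb : IsGLB Y (sInf Y) := isGLB_csInf hYne hYbdd
  refine ⟨sInf Y, ?_, hglb⟩
  have hUlim : Tendsto U atTop (𝓝 (sInf Y)) := by
    rw [tendsto_order]
    refine ⟨fun a ha => ?_, fun b hb => ?_⟩
    · -- for `a ≥ 0` the dual infimum is positive, and strictly feasible functions exist
      rcases lt_or_ge a 0 with h0 | h0
      · exact hU0.mono fun n hn => h0.trans_le hn
      · obtain ⟨F, hF1, hF2, hF3, hF4⟩ := exists_strictly_feasible (A := α ^ 2 + θ ^ 2) (B := B)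
          (θ := θ) (σ := σ) hpq.symm.lt (by positivity) hP0 hP2 hP2pos
          (fun lam η ν hl hη => hglb.1 ⟨lam, η, ν, hl, hη, rfl⟩) (h0.trans_lt ha) ha
        exact eventually_lt_integral_supportFn hd' hpq hα hε₀ hweak hP2 hmom2 hσ hP0 hB hμp hne
          hP2pos F hF1 hF2 hF3 hF4
    · obtain ⟨y, hy, hyb⟩ := exists_lt_of_csInf_lt hYne hb
      exact hup y hy b hyb
  have hN := tendsto_integral_sqrt_avg_sq hd' hweak hP2 hmom2
  have hlim := hUlim.div hN one_ne_zero
  rw [div_one] at hlim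
  refine hlim.congr' ?_
  filter_upwards [hdpos, (tendsto_order.1 hN).1 0 one_pos] with n h1 h2
  exact (sphericalWidth_eq h1 _ h2.ne').symm
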